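/- Let $n\ge 1$ and let $R$ be the root system of type $B_n$ or $C_n$ in $\mathbb R^n$ (standard basis $e_1,\dots,e_n$, $e_{-a}:=-e_a$) with simple roots $\alpha_1=e_1$ (type $B_n$) or $\alpha_1=2e_1$ (type $C_n$), and $\alpha_i=e_i-e_{i-1}$ for $2\le i\le n$. Let $W$ be its Weyl group, generated by $s_i=s_{\alpha_i}$, with the Bruhat order; write $w=(a_1,\dots,a_n)$ if $w(e_j)=e_{a_j}$ for all $j$. Let $\omega_r$ ($1\le r\le n$) be the fundamental weights, and let $W^{I_r}=\{w\in W: w(\alpha_j)\in R^+ \text{ for all } j\ne r\}$. For a weight $\chi$, write $\chi\ge 0$ if $\chi$ is a nonnegative real combination of simple roots, and $\chi\le 0$ if $-\chi\ge 0$. For integers $p\ge 0$ and $s,t$, let $J_{p,[s,t]}$ be the set of sequences $(i_1,\dots,i_p)$ of integers in $[s,t]$ with $i_{k+1}-i_k\ge 2$ for all $k$. For $\underline i=(i_1,\dots,i_m)$ put $[\underline i]=\{i_1,\dots,i_m\}$, $\underline i'=(i_1-1,\dots,i_m-1)$ and $-\underline i=(-i_m,\dots,-i_1)$. For a set $S$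 of integers, $S\uparrow$ lists its elements in increasing order. Then the set of all minimal elements (in the Bruhat order) of $\{w\in W^{I_r}: w(\omega_r)\le 0\}$ is as follows. (i) If $r=1$, it consists of the single element $w=(-n,-(n-2),\dots,-4,-2,1,3,\dots,n-3,n-1)$ if $n$ is even, and $w=(-n,-(n-2),\dots,-3,-1,2,4,\dots,n-3,n-1)$ if $n$ is odd. (ii) Let $2\le r\le n-1$ and $n+1-r=2m$. For each $\underline i\in J_{m,[2,n]}$ there is a unique $v_{\underline i}\in W^{I_r}$ with $v_{\underline i}(\omega_r)=\sum_{k=1}^m\alpha_{i_k}$, namely $v_{\underline i}=([1,n]\setminus([\underline i]\cup[\underline i'])\uparrow,\,-\underline i',\,\underline i)$. Put $w_{\underline i}=s_{i_1}s_{i_2}\cdots s_{i_m}v_{\underline i}$. Then $w_{\underline i}=([1,n]\setminus([\underline i]\cup[\underline i'])\uparrow,\,-\underline i,\,\underline i')$ and $w_{\underline i}(\omega_r)=-v_{\underline i}(\omega_r)$, and the minimal elements are exactly the $w_{\underline i}$, $\underline i\in J_{m,[2,n]}$. (iii) Let $2\le r\le n-1$ and $n+1-r=2m+1$. For each $\underline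 i\in J_{m,[3,n]}$ there is a unique $v_{\underline i}\in W^{I_r}$ with $v_{\underline i}(\omega_r)=c\,\alpha_1+\sum_{k=1}^m\alpha_{i_k}$, where $c=1$ in type $B_n$ and $c=\tfrac12$ in type $C_n$, namely $v_{\underline i}=([1,n]\setminus(\{1\}\cup[\underline i]\cup[\underline i'])\uparrow,\,-\underline i',\,1,\,\underline i)$. Put $w_{\underline i}=s_1s_{i_1}s_{i_2}\cdots s_{i_m}v_{\underline i}$. Then $w_{\underline i}=([1,n]\setminus(\{1\}\cup[\underline i]\cup[\underline i'])\uparrow,\,-\underline i,\,-1,\,\underline i')$ and $w_{\underline i}(\omega_r)=-v_{\underline i}(\omega_r)$, and the minimal elements are exactly the $w_{\underline i}$, $\underline i\in J_{m,[3,n]}$. (iv) If $r=n$, it consists of the single element $w=(2,3,\dots,n-1,n,-1)$. -/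

import Mathlib

/-- The two families of root systems: `B` for type `B_n`, `C` for type `C_n`. -/
inductive BCType : Type
  | B
  | C

namespace BCType

noncomputable section

/-- The Euclidean space spanned by the weights; its standard basis is `e 1, …, e n`. -/
abbrev V (n : ℕ) : Type := EuclideanSpace ℝ (Fin n)

/-- The vector `e a` for an integer `a`: the `a`-th standard basis vector for `1 ≤ a ≤ n`, with
`e (-a) = -e a` (and `e a = 0` for all the other values of `a`). -/
def e (n : ℕ) (a : ℤ) : V n :=
  WithLp.toLp 2 (fun k : Fin n =>
    if a = (k : ℤ) + 1 then (1 : ℝ) else if a = -((k : ℤ) + 1) then -1 else 0)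

/-- The length of the special simple root: `e 1` is a root in type `B_n`, `2 e 1` in type `C_n`. -/
def specialLength : BCType → ℝ
  | B => 1
  | C => 2

/-- The simple roots `α_1, …, α_n`, where `α_1` is the special node of the Dynkin diagram:
`α_1 = e 1` (type `B_n`) or `2 e 1` (type `C_n`), and `α_i = e i - e (i - 1)` for `2 ≤ i ≤ n`. -/
def simpleRoot (t : BCType) (n : ℕ) (i : ℤ) : V n :=
  if i = 1 then t.specialLength • e n 1 else e n i - e n (i - 1)

/-- The set `R` of all roots: `±e a` (type `B_n`) or `±2 e a` (type `C_n`), together with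
`±e a ± e b` for `a ≠ b`. -/
def roots (t : BCType) (n : ℕ) : Set (V n) :=
  {x | ∃ a : ℤ, 1 ≤ |a| ∧ |a| ≤ n ∧ x = t.specialLength • e n a} ∪
  {x | ∃ a b : ℤ, 1 ≤ |a| ∧ |a| ≤ n ∧ 1 ≤ |b| ∧ |b| ≤ n ∧ |a| ≠ |b| ∧ x = e n a + e n b}

/-- `x ≥ 0` in the dominance order: `x` is a nonnegative real combination of simple roots. -/
def IsNonneg (t : BCType) (n : ℕ) (x : V n) : Prop :=
  ∃ c : ℤ → ℝ, (∀ j ∈ Finset.Icc (1 : ℤ) n, 0 ≤ c j) ∧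
    x = ∑ j ∈ Finset.Icc (1 : ℤ) n, c j • simpleRoot t n j

/-- `x ≤ 0` in the dominance order. -/
def IsNonpos (t : BCType) (n : ℕ) (x : V n) : Prop := IsNonneg t n (-x)

/-- The set `R⁺` of positive roots. -/
def posRoots (t : BCType) (n : ℕ) : Set (V n) := {x | x ∈ roots t n ∧ IsNonneg t n x}

/-- `ω` is the fundamental weight `ω_r`: `⟨ω, α_j^∨⟩ = δ_{jr}`, where
`⟨χ, α^∨⟩ = 2 (χ, α) / (α, α)`. -/
def IsFundamentalWeight (t : BCType) (n : ℕ) (r : ℤ) (ω : V n) : Prop :=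
  ∀ j ∈ Finset.Icc (1 : ℤ) n,
    2 * inner ℝ ω (simpleRoot t n j) / inner ℝ (simpleRoot t n j) (simpleRoot t n j) =
      if j = r then 1 else 0

/-- The reflection `s_β` in the hyperplane orthogonal to `β`. -/
def refl (n : ℕ) (β : V n) : V n ≃ₗᵢ[ℝ] V n := (ℝ ∙ β)ᗮ.reflection

/-- The simple reflection `s_i`. -/
def s (t : BCType) (n : ℕ) (i : ℤ) : V n ≃ₗᵢ[ℝ] V n := refl n (simpleRoot t n i)

/-- The Weyl group `W`, generated by the simple reflections `s_1, …, s_n`. -/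
def weylGroup (t : BCType) (n : ℕ) : Subgroup (V n ≃ₗᵢ[ℝ] V n) :=
  Subgroup.closure (s t n '' Set.Icc (1 : ℤ) n)

/-- The product `s_{i_1} s_{i_2} ⋯ s_{i_m}` for a sequence `(i_1, …, i_m)`. -/
def wordProd (t : BCType) (n : ℕ) (l : List ℤ) : V n ≃ₗᵢ[ℝ] V n := (l.map (s t n)).prod

/-- The length of `w ∈ W`: the least length of a word in the simple reflections with product `w`. -/
def length (t : BCType) (n : ℕ) (w : V n ≃ₗᵢ[ℝ] V n) : ℕ :=
  sInf {k | ∃ l : List ℤ, (∀ i ∈ l, i ∈ Set.Icc (1 : ℤ) n) ∧ l.length = k ∧ wordProd t n l = w}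

/-- The Bruhat order on `W`: `u ≤ w` if `w` is reached from `u` by successive multiplications by
reflections `s_β`, `β` a root, each of which increases the length. -/
def BruhatLE (t : BCType) (n : ℕ) (u w : V n ≃ₗᵢ[ℝ] V n) : Prop :=
  Relation.ReflTransGen
    (fun x y => ∃ β ∈ roots t n, y = refl n β * x ∧ length t n x < length t n y) u w

/-- The set `W^I` of minimal coset representatives, for a set `I` of (indices of) simple roots:
the `w ∈ W` such that `w(α_j)` is a positive root for every simple root `α_j` not in `I`. -/
def minReps (t : BCType) (n : ℕ) (I : Set ℤ) : Set (V n ≃ₗᵢ[ℝ] V n) :=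
  {w | w ∈ weylGroup t n ∧ ∀ j ∈ Set.Icc (1 : ℤ) n, j ∉ I → w (simpleRoot t n j) ∈ posRoots t n}

/-- The set of all minimal elements, for the Bruhat order, of `{w ∈ W^I : w(ω) ≤ 0}`. -/
def minimalNonpos (t : BCType) (n : ℕ) (I : Set ℤ) (ω : V n) : Set (V n ≃ₗᵢ[ℝ] V n) :=
  {w | (w ∈ minReps t n I ∧ IsNonpos t n (w ω)) ∧
    ∀ u ∈ minReps t n I, IsNonpos t n (u ω) → BruhatLE t n u w → u = w}

/-- `w` is the signed permutation written `(a_1, …, a_n)` in one-line notation, that is,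
`w(e j) = e (a_j)` for `j = 1, …, n`. -/
def HasOneLine (n : ℕ) (w : V n ≃ₗᵢ[ℝ] V n) (a : List ℤ) : Prop :=
  (∀ x ∈ a, 1 ≤ |x| ∧ |x| ≤ n) ∧
    List.ofFn (fun j : Fin n => w (e n ((j : ℤ) + 1))) = a.map (e n)

/-- The set `J_{p,[a,b]}` of sequences `(i_1, …, i_p)` of elements of `[a, b]` with
`i_{k+1} - i_k ≥ 2` for all `k`. -/
def J (p : ℕ) (a b : ℤ) : Set (List ℤ) :=
  {i | i.length = p ∧ (∀ x ∈ i, a ≤ x ∧ x ≤ b) ∧ i.IsChain (fun x y => 2 ≤ y - x)}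

/-- `-i = (-i_m, …, -i_1)` for a sequence `i = (i_1, …, i_m)`. -/
def negSeq (i : List ℤ) : List ℤ := (i.map (fun x => -x)).reverse

/-- `i' = (i_1 - 1, …, i_m - 1)` for a sequence `i = (i_1, …, i_m)`. -/
def predSeq (i : List ℤ) : List ℤ := i.map (fun x => x - 1)

/-- `([1, n] \ S) ↑`: the elements of `[1, n]` outside `S`, in increasing order. -/
def complUp (n : ℕ) (S : Finset ℤ) : List ℤ := (Finset.Icc (1 : ℤ) n \ S).sort (· ≤ ·)

end

end BCType

/-!
The weight `w(ω_r)` is, up to a positive factor, a vector with entries in `{-1, 0, 1}` that has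
`n + 1 - r` nonzero entries, and it is nonpositive if and only if all its tail sums are. An element
`w` of the given set that is minimal has no simple reflection `s_i` for which `s_i w` is shorter
and stays in the set. This forces `w(ω_r)` to be minus a sum of simple roots (with `α_1` normalised
to `e_1`) whose indices are pairwise non-adjacent, and then the word of these indices takes `w(ω_r)`
to its negative. All elements whose weight has this form have the same length, so none of them lies
below another one, and they are exactly the minimal elements.
-/

namespace SignedPerm

open Finset

noncomputable section

variable {n r : ℕ} {i : ℤ} {f g : ℤ → ℤ} {l L : List ℤ} {σ τ : Equiv.Perm ℤ}

lemma odd_comp (hf : f.Odd) (hg : g.Odd) : (f ∘ g).Odd := fun a => by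
  simp only [Function.comp_apply, hg a, hf (g a)]

lemma odd_ext (hf : f.Odd) (hg : g.Odd) (h : ∀ a, 1 ≤ a → f a = g a) : f = g := by
  funext a
  rcases lt_trichotomy a 0 with ha | rfl | ha
  · rw [← neg_neg a, hf, hg, h _ (by omega)]
  · rw [hf.map_zero, hg.map_zero]
  · exact h a ha

/-! ### Simple reflections and signed permutations -/

/-- The simple reflection `s_i` of type `B`/`C` acting on the indices `a` of the vectors `e a`. For
`i ≤ 0` it is the identity, so that it is an involution for every `i`. -/
def simpleRefl (i a : ℤ) : ℤ :=
  if i ≤ 0 then a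
  else if i = 1 then (if a = 1 then -1 else if a = -1 then 1 else a)
  else if a = i then i - 1
  else if a = i - 1 then i
  else if a = -i then -(i - 1)
  else if a = -(i - 1) then -i
  else a

lemma simpleRefl_simpleRefl (i a : ℤ) : simpleRefl i (simpleRefl i a) = a := by
  grind (splits := 20) [simpleRefl]

lemma simpleRefl_odd (i : ℤ) : (simpleRefl i).Odd := fun a => by
  unfold simpleRefl; split_ifs <;> omega

lemma simpleRefl_of_lt_abs {a m : ℤ} (hi : i ≤ m) (ha : m < |a|) : simpleRefl i a = a := by
  rcases lt_abs.1 ha with h | h <;> (unfold simpleRefl; split_ifs <;> omega)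

lemma simpleRefl_self (hi : 2 ≤ i) : simpleRefl i i = i - 1 := by
  unfold simpleRefl; split_ifs <;> omega

lemma simpleRefl_pred (hi : 2 ≤ i) : simpleRefl i (i - 1) = i := by
  unfold simpleRefl; split_ifs <;> omega

lemma simpleRefl_one_one : simpleRefl 1 1 = -1 := rfl

lemma simpleRefl_of_ne {a : ℤ} (ha : 1 ≤ a) (h₁ : a ≠ i) (h₂ : a ≠ i - 1) : simpleRefl i a = a := by
  unfold simpleRefl; split_ifs <;> omega

lemma simpleRefl_lt {a b : ℤ} (h : a < b) (h₁ : ¬(a = i - 1 ∧ b = i))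
    (h₂ : ¬(a = -i ∧ b = -(i - 1))) (h₃ : b ≠ -a) : simpleRefl i a < simpleRefl i b := by
  unfold simpleRefl; split_ifs <;> omega

/-- The simple reflection `s_i` as a permutation of the indices. -/
def simplePerm (i : ℤ) : Equiv.Perm ℤ :=
  Function.Involutive.toPerm (simpleRefl i) (simpleRefl_simpleRefl i)

@[simp] lemma simplePerm_apply (i a : ℤ) : simplePerm i a = simpleRefl i a := rfl

lemma simplePerm_mul_self (i : ℤ) : simplePerm i * simplePerm i = 1 :=
  Equiv.ext (simpleRefl_simpleRefl i)

lemma simplePerm_inv (i : ℤ) : (simplePerm i)⁻¹ = simplePerm i :=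
  inv_eq_of_mul_eq_one_left (simplePerm_mul_self i)

/-- The signed permutations of `[-n, n]`, extended by the identity to `ℤ`. -/
def signedPerms (n : ℕ) : Subgroup (Equiv.Perm ℤ) where
  carrier := {σ | Function.Odd σ ∧ ∀ a, (n : ℤ) < |a| → σ a = a}
  one_mem' := ⟨fun _ => rfl, fun _ _ => rfl⟩
  mul_mem' := fun ⟨hσ, hσn⟩ ⟨hτ, hτn⟩ =>
    ⟨fun a => odd_comp hσ hτ a, fun a ha => by rw [Equiv.Perm.mul_apply, hτn a ha, hσn a ha]⟩
  inv_mem' := fun ⟨hσ, hσn⟩ =>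
    ⟨fun a => by rw [Equiv.Perm.inv_eq_iff_eq, hσ, ← Equiv.Perm.mul_apply, mul_inv_cancel,
        Equiv.Perm.one_apply],
      fun a ha => by rw [Equiv.Perm.inv_eq_iff_eq, hσn a ha]⟩

lemma odd_of_mem (hσ : σ ∈ signedPerms n) : Function.Odd σ := hσ.1

lemma simplePerm_mem (hi : i ≤ n) : simplePerm i ∈ signedPerms n :=
  ⟨simpleRefl_odd i, fun _ ha => simpleRefl_of_lt_abs hi ha⟩

lemma map_zero_of_mem (hσ : σ ∈ signedPerms n) : σ 0 = 0 := (odd_of_mem hσ).map_zero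

lemma abs_map_le (hσ : σ ∈ signedPerms n) {a : ℤ} (ha : |a| ≤ n) : |σ a| ≤ n := by
  by_contra! h
  rw [σ.injective (hσ.2 (σ a) h)] at h
  exact h.not_ge ha

lemma one_le_abs_map (hσ : σ ∈ signedPerms n) {a : ℤ} (ha : a ≠ 0) : 1 ≤ |σ a| :=
  Int.one_le_abs fun h => ha (σ.injective (h.trans (map_zero_of_mem hσ).symm))

lemma eq_one_of_increasing (hσ : σ ∈ signedPerms n)
    (h : ∀ i ∈ Set.Icc (1 : ℤ) n, σ (i - 1) < σ i) : σ = 1 := by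
  have expanding : ∀ a b : ℤ, 0 ≤ a → a ≤ b → b ≤ n → σ a + (b - a) ≤ σ b := by
    intro a b ha hab
    induction b, hab using Int.leInduction with
    | base => intro _; omega
    | succ b hab ih =>
      intro hb
      have := ih (by omega)
      have := h (b + 1) ⟨by omega, hb⟩
      rw [add_sub_cancel_right] at this
      omega
  refine DFunLike.coe_injective (odd_ext (odd_of_mem hσ) (fun _ => rfl) fun a ha => ?_)
  rw [Equiv.Perm.one_apply]
  rcases lt_or_ge (n : ℤ) a with han | han
  · exact hσ.2 a (han.trans_le (le_abs_self a))
  · have lower := expanding 0 a le_rfl (by omega) han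
    have upper := expanding a n (by omega) han le_rfl
    have := (abs_le.1 (abs_map_le hσ (a := n) (by simp))).2
    rw [map_zero_of_mem hσ] at lower
    omega

lemma exists_descent (hσ : σ ∈ signedPerms n) (h : σ ≠ 1) :
    ∃ i ∈ Set.Icc (1 : ℤ) n, σ i < σ (i - 1) := by
  by_contra! hle
  refine h (eq_one_of_increasing hσ fun i hi => (hle i hi).lt_of_ne fun heq => ?_)
  have := σ.injective heq
  omega

/-! ### Inversions -/

/-- The pairs `(a, b)` of indices standing for the positive roots: `e b - e a` for `a ≠ 0` and
(a multiple of) `e b` for `a = 0`. -/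
def pairs (n : ℕ) : Finset (ℤ × ℤ) :=
  (Icc (-n : ℤ) n ×ˢ Icc (1 : ℤ) n).filter fun p => -p.2 < p.1 ∧ p.1 < p.2

lemma mem_pairs {p : ℤ × ℤ} : p ∈ pairs n ↔ -p.2 < p.1 ∧ p.1 < p.2 ∧ p.2 ≤ n := by
  simp only [pairs, mem_filter, mem_product, mem_Icc]
  omega

/-- The number of pairs in `pairs n` whose values under `f` are in the relation `R`. -/
def countPairs (n : ℕ) (R : ℤ → ℤ → Prop) [DecidableRel R] (f : ℤ → ℤ) : ℕ :=
  ((pairs n).filter fun p => R (f p.1) (f p.2)).card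

/-- The action of `s_i` on the pairs other than `(i - 1, i)`, with `(a, b)` identified with
`(-b, -a)`; the pair `(-(i - 1), i)`, which stands for `e i + e (i - 1)`, is fixed. -/
def pairMap (i : ℤ) (p : ℤ × ℤ) : ℤ × ℤ :=
  if p = (-(i - 1), i) then p else (simpleRefl i p.1, simpleRefl i p.2)

lemma pairMap_mem (hi : i ∈ Set.Icc (1 : ℤ) n) {p : ℤ × ℤ}
    (hp : p ∈ (pairs n).erase (i - 1, i)) : pairMap i p ∈ (pairs n).erase (i - 1, i) := by
  obtain ⟨a, b⟩ := p
  obtain ⟨h₁, hn⟩ := hi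
  simp only [mem_erase, mem_pairs, ne_eq, Prod.mk.injEq, pairMap] at *
  split_ifs with h <;> simp only [Prod.mk.injEq]
  · omega
  · unfold simpleRefl
    split_ifs <;> omega

lemma pairMap_pairMap {p : ℤ × ℤ} (hp : p ∈ (pairs n).erase (i - 1, i)) :
    pairMap i (pairMap i p) = p := by
  obtain ⟨a, b⟩ := p
  by_cases h : (a, b) = (-(i - 1), i)
  · rw [pairMap, pairMap, if_pos h, if_pos h]
  · have h' : (simpleRefl i a, simpleRefl i b) ≠ (-(i - 1), i) := by
      simp only [mem_erase, mem_pairs, ne_eq, Prod.mk.injEq] at hp h ⊢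
      unfold simpleRefl
      split_ifs <;> omega
    rw [show pairMap i (a, b) = (simpleRefl i a, simpleRefl i b) from if_neg h, pairMap, if_neg h']
    simp only [simpleRefl_simpleRefl]

lemma rel_pairMap {R : ℤ → ℤ → Prop} (hR : ∀ a b, R a b → R (-b) (-a)) (hf : f.Odd) (hi : 1 ≤ i)
    {p : ℤ × ℤ} (hp : p ≠ (i - 1, i)) (h : R (f p.1) (f p.2)) :
    R (f (simpleRefl i (pairMap i p).1)) (f (simpleRefl i (pairMap i p).2)) := by
  unfold pairMap
  split_ifs with hfix
  · subst hfix
    have hi₂ : 2 ≤ i := by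
      by_contra! hlt
      obtain rfl : i = 1 := by omega
      simp at hp
    have h' := hR _ _ h
    rw [← hf, ← hf, neg_neg] at h'
    simpa only [simpleRefl_odd i _, simpleRefl_self hi₂, simpleRefl_pred hi₂] using h'
  · simpa only [simpleRefl_simpleRefl] using h

lemma card_erase_comp_simpleRefl {R : ℤ → ℤ → Prop} [DecidableRel R]
    (hR : ∀ a b, R a b → R (-b) (-a)) (hf : f.Odd) (hi : i ∈ Set.Icc (1 : ℤ) n) :
    (((pairs n).erase (i - 1, i)).filter fun p =>
        R (f (simpleRefl i p.1)) (f (simpleRefl i p.2))).card =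
      (((pairs n).erase (i - 1, i)).filter fun p => R (f p.1) (f p.2)).card := by
  refine card_nbij' (pairMap i) (pairMap i) (fun p hp => ?_) (fun p hp => ?_)
    (fun p hp => ?_) (fun p hp => ?_) <;>
    simp only [coe_filter, Set.mem_ofPred_eq] at hp ⊢
  · refine ⟨pairMap_mem hi hp.1, ?_⟩
    simpa only [Function.comp_apply, simpleRefl_simpleRefl] using
      rel_pairMap hR (odd_comp hf (simpleRefl_odd i)) hi.1 (mem_erase.1 hp.1).1 hp.2
  · exact ⟨pairMap_mem hi hp.1, rel_pairMap hR hf hi.1 (mem_erase.1 hp.1).1 hp.2⟩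
  · exact pairMap_pairMap hp.1
  · exact pairMap_pairMap hp.1

lemma card_filter_erase_add {α : Type*} [DecidableEq α] (s : Finset α) (p : α → Prop)
    [DecidablePred p] {a : α} (ha : a ∈ s) :
    ((s.erase a).filter p).card + (if p a then 1 else 0) = (s.filter p).card := by
  conv_rhs => rw [← insert_erase ha, filter_insert]
  split_ifs with h
  · rw [card_insert_of_notMem (by simp)]
  · rw [add_zero]

lemma rel_comp_simpleRefl {R : ℤ → ℤ → Prop} (hR : ∀ a b, R a b → R (-b) (-a)) (hf : f.Odd)
    (hi : 1 ≤ i) : R (f (simpleRefl i (i - 1))) (f (simpleRefl i i)) ↔ R (f i) (f (i - 1)) := by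
  rcases eq_or_lt_of_le hi with rfl | hi₂
  · simp only [sub_self, (simpleRefl_odd 1).map_zero, simpleRefl_one_one, hf 1, hf.map_zero]
    exact ⟨fun h => by simpa using hR _ _ h, fun h => by simpa using hR _ _ h⟩
  · rw [simpleRefl_self (by omega), simpleRefl_pred (by omega)]

lemma countPairs_comp_simpleRefl {R : ℤ → ℤ → Prop} [DecidableRel R]
    (hR : ∀ a b, R a b → R (-b) (-a)) (hf : f.Odd) (hi : i ∈ Set.Icc (1 : ℤ) n) :
    countPairs n R (f ∘ simpleRefl i) + (if R (f (i - 1)) (f i) then 1 else 0) =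
      countPairs n R f + (if R (f i) (f (i - 1)) then 1 else 0) := by
  have hmem : (i - 1, i) ∈ pairs n := mem_pairs.2 ⟨by have := hi.1; simp only; omega, by simp, hi.2⟩
  have count := card_filter_erase_add (pairs n) (fun p => R (f p.1) (f p.2)) hmem
  have count' := card_filter_erase_add (pairs n)
    (fun p => R (f (simpleRefl i p.1)) (f (simpleRefl i p.2))) hmem
  rw [card_erase_comp_simpleRefl hR hf hi] at count'
  simp only [rel_comp_simpleRefl hR hf hi.1] at count count'
  simp only [countPairs, Function.comp_apply]
  omega

/-- The number of inversions of an odd function on `[-n, n]`, counted by positive roots. -/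
def inversions (n : ℕ) (f : ℤ → ℤ) : ℕ := countPairs n (fun a b => b < a) f

/-- The number of pairs in `pairs n` on which `f` takes distinct values; unlike the number of
inversions, it is invariant under signed permutations. -/
def distinctPairs (n : ℕ) (f : ℤ → ℤ) : ℕ := countPairs n (fun a b => a ≠ b) f

lemma inversions_add_inversions_neg (n : ℕ) (f : ℤ → ℤ) :
    inversions n f + inversions n (-f) = distinctPairs n f := by
  have hdisj : Disjoint ((pairs n).filter fun p => f p.2 < f p.1)
      ((pairs n).filter fun p => (-f) p.2 < (-f) p.1) :=
    disjoint_filter.2 fun p _ h => by simp only [Pi.neg_apply]; omega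
  rw [inversions, inversions, distinctPairs, countPairs, countPairs, countPairs,
    ← card_union_of_disjoint hdisj, ← filter_or]
  congr 1
  exact filter_congr fun p _ => by simp only [Pi.neg_apply]; omega

lemma inversions_comp_simpleRefl_of_lt (hf : f.Odd) (hi : i ∈ Set.Icc (1 : ℤ) n)
    (h : f (i - 1) < f i) : inversions n (f ∘ simpleRefl i) = inversions n f + 1 := by
  have := countPairs_comp_simpleRefl (R := fun a b => b < a) (by omega) hf hi
  rwa [if_neg (by omega), if_pos h] at this

lemma inversions_comp_simpleRefl_of_gt (hf : f.Odd) (hi : i ∈ Set.Icc (1 : ℤ) n)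
    (h : f i < f (i - 1)) : inversions n (f ∘ simpleRefl i) + 1 = inversions n f := by
  have := countPairs_comp_simpleRefl (R := fun a b => b < a) (by omega) hf hi
  rwa [if_neg (c := f (i - 1) < f i) (by omega), if_pos h] at this

lemma inversions_comp_simpleRefl_le (hf : f.Odd) (hi : i ∈ Set.Icc (1 : ℤ) n) :
    inversions n (f ∘ simpleRefl i) ≤ inversions n f + 1 := by
  have := countPairs_comp_simpleRefl (R := fun a b => b < a) (by omega) hf hi
  unfold inversions
  split_ifs at this <;> omega

lemma distinctPairs_comp_simpleRefl (hf : f.Odd) (hi : i ∈ Set.Icc (1 : ℤ) n) :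
    distinctPairs n (f ∘ simpleRefl i) = distinctPairs n f := by
  have := countPairs_comp_simpleRefl (R := fun a b => a ≠ b) (by omega) hf hi
  unfold distinctPairs
  split_ifs at this <;> omega

/-! ### Words in the simple reflections -/

/-- The product of the simple reflections in a word, as a permutation of the indices. -/
def wordPerm (l : List ℤ) : Equiv.Perm ℤ := (l.map simplePerm).prod

lemma wordPerm_mem (hl : ∀ i ∈ l, i ≤ (n : ℤ)) : wordPerm l ∈ signedPerms n :=
  Subgroup.list_prod_mem _ fun _ hσ =>
    let ⟨i, hi, h⟩ := List.mem_map.1 hσ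
    h ▸ simplePerm_mem (hl i hi)

lemma wordPerm_cons (i : ℤ) (l : List ℤ) : wordPerm (i :: l) = simplePerm i * wordPerm l := by
  simp [wordPerm]

lemma wordPerm_append_singleton (l : List ℤ) (i : ℤ) :
    wordPerm (l ++ [i]) = wordPerm l * simplePerm i := by
  simp [wordPerm]

lemma wordPerm_reverse (l : List ℤ) : wordPerm l.reverse = (wordPerm l)⁻¹ := by
  simp [wordPerm, List.prod_inv_reverse, Function.comp_def, simplePerm_inv]

lemma inversions_one (n : ℕ) : inversions n (1 : Equiv.Perm ℤ) = 0 :=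
  card_eq_zero.2 (filter_eq_empty_iff.2 fun p hp => by
    have := mem_pairs.1 hp
    simp only [Equiv.Perm.one_apply]
    omega)

lemma exists_wordPerm_eq (hσ : σ ∈ signedPerms n) :
    ∃ l : List ℤ, (∀ i ∈ l, i ∈ Set.Icc (1 : ℤ) n) ∧ l.length = inversions n σ ∧
      wordPerm l = σ := by
  induction hk : inversions n σ using Nat.strong_induction_on generalizing σ with
  | _ k ih =>
    by_cases hone : σ = 1
    · subst hone
      exact ⟨[], by simp, by rw [← hk, inversions_one, List.length_nil], rfl⟩
    obtain ⟨i, hi, hdesc⟩ := exists_descent hσ hone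
    have hinv : inversions n (σ * simplePerm i : Equiv.Perm ℤ) + 1 = inversions n σ :=
      inversions_comp_simpleRefl_of_gt (odd_of_mem hσ) hi hdesc
    obtain ⟨l, hl, hlen, hw⟩ := ih _ (by omega) (mul_mem hσ (simplePerm_mem hi.2)) rfl
    refine ⟨l ++ [i], ?_, by rw [List.length_append, List.length_singleton]; omega, ?_⟩
    · simpa only [List.forall_mem_append, List.forall_mem_singleton] using ⟨hl, hi⟩
    · rw [wordPerm_append_singleton, hw, mul_assoc, simplePerm_mul_self, mul_one]

lemma inversions_wordPerm_le (hl : ∀ i ∈ l, i ∈ Set.Icc (1 : ℤ) n) :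
    inversions n (wordPerm l) ≤ l.length := by
  induction l using List.reverseRecOn with
  | nil => exact (inversions_one n).le
  | append_singleton l i ih =>
    simp only [List.forall_mem_append, List.forall_mem_singleton] at hl
    have hodd := odd_of_mem (wordPerm_mem fun j hj => (hl.1 j hj).2)
    rw [wordPerm_append_singleton, List.length_append, List.length_singleton]
    exact (inversions_comp_simpleRefl_le hodd hl.2).trans (Nat.succ_le_succ (ih hl.1))

lemma inversions_inv_le (hσ : σ ∈ signedPerms n) :
    inversions n (σ⁻¹ : Equiv.Perm ℤ) ≤ inversions n σ := by
  obtain ⟨l, hl, hlen, rfl⟩ := exists_wordPerm_eq hσ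
  rw [← hlen, ← wordPerm_reverse, ← List.length_reverse]
  exact inversions_wordPerm_le (by simpa using hl)

lemma inversions_inv (hσ : σ ∈ signedPerms n) :
    inversions n (σ⁻¹ : Equiv.Perm ℤ) = inversions n σ :=
  le_antisymm (inversions_inv_le hσ) (by simpa using inversions_inv_le (inv_mem hσ))

lemma distinctPairs_comp (hσ : σ ∈ signedPerms n) (hf : f.Odd) :
    distinctPairs n (f ∘ σ) = distinctPairs n f := by
  obtain ⟨l, hl, -, rfl⟩ := exists_wordPerm_eq hσ
  clear hσ
  induction l using List.reverseRecOn with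
  | nil => rfl
  | append_singleton l i ih =>
    simp only [List.forall_mem_append, List.forall_mem_singleton] at hl
    have hodd := odd_comp hf (odd_of_mem (wordPerm_mem fun j hj => (hl.1 j hj).2))
    rw [← ih hl.1, ← distinctPairs_comp_simpleRefl hodd hl.2, wordPerm_append_singleton]
    rfl

/-! ### Minimal coset representatives -/

/-- The coordinates of a vector of `{-1, 0, 1}ⁿ`, as an odd function of the index. -/
structure IsSignVector (n : ℕ) (f : ℤ → ℤ) : Prop where
  odd : f.Odd
  bounds : ∀ a, -1 ≤ f a ∧ f a ≤ 1
  eq_zero : ∀ a, (n : ℤ) < |a| → f a = 0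

lemma IsSignVector.comp (hf : IsSignVector n f) (hσ : σ ∈ signedPerms n) :
    IsSignVector n (f ∘ σ) :=
  ⟨odd_comp hf.odd (odd_of_mem hσ), fun a => hf.bounds (σ a),
    fun a ha => by rw [Function.comp_apply, hσ.2 a ha, hf.eq_zero a ha]⟩

lemma IsSignVector.comp_simpleRefl (hf : IsSignVector n f) (hi : i ≤ n) :
    IsSignVector n (f ∘ simpleRefl i) :=
  hf.comp (simplePerm_mem hi)

lemma IsSignVector.neg (hf : IsSignVector n f) : IsSignVector n (-f) :=
  ⟨fun a => by simp only [Pi.neg_apply, hf.odd a],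
    fun a => by have := hf.bounds a; simp only [Pi.neg_apply]; omega,
    fun a ha => by rw [Pi.neg_apply, hf.eq_zero a ha, neg_zero]⟩

/-- The coordinates of the weight `e r + ⋯ + e n`, as an odd function of the index. -/
def fundWeight (n r : ℕ) (a : ℤ) : ℤ :=
  if r ≤ a ∧ a ≤ n then 1 else if r ≤ -a ∧ -a ≤ n then -1 else 0

lemma fundWeight_isSignVector (hr : 1 ≤ r) : IsSignVector n (fundWeight n r) where
  odd a := by unfold fundWeight; split_ifs <;> omega
  bounds a := by unfold fundWeight; split_ifs <;> omega
  eq_zero a ha := by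
    rcases lt_abs.1 ha with h | h <;> (unfold fundWeight; split_ifs <;> omega)

lemma fundWeight_ne_zero_iff {a : ℤ} (ha : 1 ≤ a) : fundWeight n r a ≠ 0 ↔ r ≤ a ∧ a ≤ n := by
  unfold fundWeight; split_ifs <;> omega

lemma fundWeight_mono (hr : 1 ≤ r) {a b : ℤ} (hab : a ≤ b) (ha : -n ≤ a) (hb : b ≤ n) :
    fundWeight n r a ≤ fundWeight n r b := by
  unfold fundWeight; split_ifs <;> omega

lemma fundWeight_pred (hr : 1 ≤ r) {j : ℤ} (hj : j ∈ Set.Icc (1 : ℤ) n) (hjr : j ≠ r) :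
    fundWeight n r (j - 1) = fundWeight n r j := by
  obtain ⟨h₁, hn⟩ := hj
  unfold fundWeight; split_ifs <;> omega

/-- The coordinates of the image of `e r + ⋯ + e n` under `σ`. -/
def weight (n r : ℕ) (σ : Equiv.Perm ℤ) : ℤ → ℤ := fundWeight n r ∘ (σ⁻¹ : Equiv.Perm ℤ)

lemma weight_map (n r : ℕ) (σ : Equiv.Perm ℤ) (a : ℤ) :
    weight n r σ (σ a) = fundWeight n r a := by
  rw [weight, Function.comp_apply, Equiv.Perm.coe_inv, Equiv.symm_apply_apply]

lemma weight_isSignVector (hr : 1 ≤ r) (hσ : σ ∈ signedPerms n) :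
    IsSignVector n (weight n r σ) :=
  (fundWeight_isSignVector hr).comp (inv_mem hσ)

lemma weight_simplePerm_mul (n r : ℕ) (i : ℤ) (σ : Equiv.Perm ℤ) :
    weight n r (simplePerm i * σ) = weight n r σ ∘ simpleRefl i := by
  rw [weight, mul_inv_rev, simplePerm_inv, weight, Function.comp_assoc]
  rfl

/-- The signed permutations of minimal length in their coset of the stabilizer of
`e r + ⋯ + e n`. -/
def IsMinRep (n r : ℕ) (σ : Equiv.Perm ℤ) : Prop :=
  σ ∈ signedPerms n ∧ ∀ j ∈ Set.Icc (1 : ℤ) n, j ≠ r → σ (j - 1) < σ j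

lemma isMinRep_one : IsMinRep n r 1 := ⟨one_mem _, fun _ _ _ => by simp⟩

lemma IsMinRep.simplePerm_mul (hσ : IsMinRep n r σ) (hr : 1 ≤ r) (hi : i ≤ n)
    (h : weight n r σ (i - 1) ≠ weight n r σ i) : IsMinRep n r (simplePerm i * σ) := by
  refine ⟨mul_mem (simplePerm_mem hi) hσ.1, fun j hj hjr => ?_⟩
  have hodd := (weight_isSignVector hr hσ.1).odd
  have hw := fundWeight_pred hr hj hjr
  rw [← weight_map n r σ, ← weight_map n r σ] at hw
  refine simpleRefl_lt (hσ.2 j hj hjr) ?_ ?_ fun heq => ?_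
  · rintro ⟨h₁, h₂⟩
    exact h (by rw [← h₁, ← h₂, hw])
  · rintro ⟨h₁, h₂⟩
    rw [h₁, h₂, hodd, hodd, neg_inj] at hw
    exact h hw.symm
  · rw [← odd_of_mem hσ.1] at heq
    have := σ.injective heq
    omega

lemma IsMinRep.lt_of_fundWeight_eq (hσ : IsMinRep n r σ) (hr : 1 ≤ r) {a b : ℤ} (ha : -n ≤ a)
    (hab : a < b) (hb : b ≤ n) (h : fundWeight n r a = fundWeight n r b) : σ a < σ b := by
  have consecutive : ∀ j : ℤ, -n < j → j ≤ n → fundWeight n r (j - 1) = fundWeight n r j →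
      σ (j - 1) < σ j := by
    intro j hjn hj heq
    rcases le_or_gt 1 j with hpos | hneg
    · refine hσ.2 j ⟨hpos, hj⟩ fun hjr => ?_
      unfold fundWeight at heq
      split_ifs at heq <;> omega
    · have := hσ.2 (1 - j) ⟨by omega, by omega⟩ fun hjr => by
        unfold fundWeight at heq
        split_ifs at heq <;> omega
      rw [show 1 - j - 1 = -j by ring, show 1 - j = -(j - 1) by ring, odd_of_mem hσ.1,
        odd_of_mem hσ.1] at this
      omega
  induction b, Int.add_one_le_of_lt hab using Int.leInduction with
  | base => simpa using consecutive (a + 1) (by omega) hb (by simpa using h)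
  | succ b hab' ih =>
    have h₁ := fundWeight_mono (n := n) hr (show a ≤ b by omega) ha (by omega)
    have h₂ := fundWeight_mono (n := n) hr (show b ≤ b + 1 by omega) (by omega) hb
    have := consecutive (b + 1) (by omega) hb (by rw [add_sub_cancel_right]; omega)
    rw [add_sub_cancel_right] at this
    exact (ih (by omega) (by omega) (by omega)).trans this

/-- The inverse of a minimal representative sorts the indices by weight, ties broken by size; so
a minimal representative is determined by its weight. -/
lemma IsMinRep.inv_lt_inv_iff (hσ : IsMinRep n r σ) (hr : 1 ≤ r) {p q : ℤ} (hp : |p| ≤ n)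
    (hq : |q| ≤ n) : σ⁻¹ p < σ⁻¹ q ↔
      weight n r σ p < weight n r σ q ∨ weight n r σ p = weight n r σ q ∧ p < q := by
  have lex : ∀ {a b : ℤ}, |a| ≤ n → |b| ≤ n → a < b →
      fundWeight n r a < fundWeight n r b ∨ fundWeight n r a = fundWeight n r b ∧ σ a < σ b := by
    intro a b ha hb hab
    have ha' := (abs_le.1 ha).1
    have hb' := (abs_le.1 hb).2
    refine (fundWeight_mono hr hab.le ha' hb').lt_or_eq.imp_right fun h => ⟨h, ?_⟩
    exact hσ.lt_of_fundWeight_eq hr ha' hab hb' h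
  obtain ⟨a, rfl⟩ := σ.surjective p
  obtain ⟨b, rfl⟩ := σ.surjective q
  have ha := abs_map_le (inv_mem hσ.1) hp
  have hb := abs_map_le (inv_mem hσ.1) hq
  simp only [Equiv.Perm.coe_inv, Equiv.symm_apply_apply, weight_map] at ha hb ⊢
  refine ⟨lex ha hb, fun h => ?_⟩
  rcases lt_trichotomy a b with hab | rfl | hba
  · exact hab
  · omega
  · have := lex hb ha hba
    omega

lemma IsMinRep.eq_of_weight_eq (hσ : IsMinRep n r σ) (hτ : IsMinRep n r τ) (hr : 1 ≤ r)
    (h : weight n r σ = weight n r τ) : σ = τ := by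
  refine (inv_mul_eq_one.1 (eq_one_of_increasing (mul_mem (inv_mem hτ.1) hσ.1) ?_)).symm
  rintro j ⟨hj, hjn⟩
  have hp := abs_map_le hσ.1 (a := j - 1) (abs_le.2 ⟨by omega, by omega⟩)
  have hq := abs_map_le hσ.1 (a := j) (abs_le.2 ⟨by omega, by omega⟩)
  rw [Equiv.Perm.mul_apply, Equiv.Perm.mul_apply, hτ.inv_lt_inv_iff hr hp hq, ← h,
    ← hσ.inv_lt_inv_iff hr hp hq, Equiv.Perm.coe_inv, Equiv.symm_apply_apply,
    Equiv.symm_apply_apply]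
  omega

lemma IsMinRep.inversions_eq (hσ : IsMinRep n r σ) (hr : 1 ≤ r) :
    inversions n σ = inversions n (weight n r σ) := by
  rw [← inversions_inv hσ.1]
  refine congrArg card (filter_congr fun p hp => ?_)
  have hp := mem_pairs.1 hp
  refine (hσ.inv_lt_inv_iff hr (abs_le.2 ⟨by omega, by omega⟩)
    (abs_le.2 ⟨by omega, by omega⟩)).trans ?_
  omega

/-- The number of nonzero coordinates. -/
def numNonzero (n : ℕ) (f : ℤ → ℤ) : ℕ := ((Icc (1 : ℤ) n).filter fun a => f a ≠ 0).card

lemma numNonzero_neg (n : ℕ) (f : ℤ → ℤ) : numNonzero n (-f) = numNonzero n f := by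
  simp only [numNonzero, Pi.neg_apply, neg_ne_zero]

lemma numNonzero_fundWeight (hr : 1 ≤ r) : numNonzero n (fundWeight n r) = n + 1 - r := by
  have : (Icc (1 : ℤ) n).filter (fun a => fundWeight n r a ≠ 0) = Icc (r : ℤ) n := by
    ext a
    rw [mem_filter, mem_Icc, mem_Icc]
    constructor
    · exact fun h => (fundWeight_ne_zero_iff h.1.1).1 h.2
    · exact fun h => ⟨by omega, (fundWeight_ne_zero_iff (by omega)).2 h⟩
  rw [numNonzero, this, Int.card_Icc]
  omega

lemma abs_map_abs_inv_map (hσ : σ ∈ signedPerms n) {a : ℤ} (ha : 0 ≤ a) : |σ (|σ⁻¹ a|)| = a := by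
  rcases abs_choice (σ⁻¹ a) with h | h <;> rw [h, Equiv.Perm.coe_inv]
  · rw [Equiv.apply_symm_apply, abs_of_nonneg ha]
  · rw [odd_of_mem hσ, Equiv.apply_symm_apply, abs_neg, abs_of_nonneg ha]

lemma numNonzero_comp (hσ : σ ∈ signedPerms n) (hf : f.Odd) :
    numNonzero n (f ∘ σ) = numNonzero n f := by
  have ne_zero_abs : ∀ {g : ℤ → ℤ} {a : ℤ}, g.Odd → (g |a| ≠ 0 ↔ g a ≠ 0) := by
    intro g a hg
    rcases abs_choice a with h | h <;> simp [h, hg a]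
  have mem_Icc_abs : ∀ {ρ : Equiv.Perm ℤ} {a : ℤ}, ρ ∈ signedPerms n → a ∈ Icc (1 : ℤ) n →
      |ρ a| ∈ Icc (1 : ℤ) n := by
    intro ρ a hρ ha
    rw [mem_Icc] at ha ⊢
    exact ⟨one_le_abs_map hρ (by omega), abs_map_le hρ (abs_le.2 ⟨by omega, ha.2⟩)⟩
  refine card_nbij' (fun a => |σ a|) (fun a => |σ⁻¹ a|) (fun a ha => ?_) (fun a ha => ?_)
    (fun a ha => ?_) (fun a ha => ?_) <;>
    simp only [coe_filter, Set.mem_ofPred_eq, Function.comp_apply] at ha ⊢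
  · exact ⟨mem_Icc_abs hσ ha.1, (ne_zero_abs hf).2 ha.2⟩
  · refine ⟨mem_Icc_abs (inv_mem hσ) ha.1, (ne_zero_abs (odd_comp hf (odd_of_mem hσ))).2 ?_⟩
    simpa using ha.2
  · have h₀ : 0 ≤ a := by have := (mem_Icc.1 ha.1).1; omega
    simpa using abs_map_abs_inv_map (inv_mem hσ) h₀
  · have h₀ : 0 ≤ a := by have := (mem_Icc.1 ha.1).1; omega
    exact abs_map_abs_inv_map hσ h₀

lemma numNonzero_weight (hr : 1 ≤ r) (hσ : σ ∈ signedPerms n) :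
    numNonzero n (weight n r σ) = n + 1 - r := by
  rw [weight, numNonzero_comp (inv_mem hσ) (fundWeight_isSignVector hr).odd,
    numNonzero_fundWeight hr]

lemma eq_fundWeight_of_monotone (hr : 1 ≤ r) (hf : IsSignVector n f)
    (hcard : numNonzero n f = n + 1 - r) (hmono : ∀ i ∈ Set.Icc (1 : ℤ) n, f (i - 1) ≤ f i) :
    f = fundWeight n r := by
  have mono : MonotoneOn f (Set.Icc 0 n) := monotoneOn_of_sub_one_le Set.ordConnected_Icc
    fun i _ hi hi' => hmono i ⟨by have := hi'.1; omega, hi.2⟩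
  have nonneg : ∀ a : ℤ, 0 ≤ a → a ≤ n → 0 ≤ f a := fun a h₀ hn =>
    hf.odd.map_zero.symm.trans_le (mono ⟨le_rfl, by omega⟩ ⟨h₀, hn⟩ h₀)
  have support_subset : ((Icc (1 : ℤ) n).filter fun a => f a ≠ 0) ⊆ Icc (r : ℤ) n := by
    intro a ha
    obtain ⟨ha, hfa⟩ := mem_filter.1 ha
    rw [mem_Icc] at ha ⊢
    have upper : Icc a n ⊆ (Icc (1 : ℤ) n).filter fun a => f a ≠ 0 := fun b hb => by
      rw [mem_Icc] at hb
      have := nonneg a (by omega) ha.2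
      have := mono ⟨by omega, ha.2⟩ ⟨by omega, hb.2⟩ hb.1
      exact mem_filter.2 ⟨mem_Icc.2 ⟨by omega, hb.2⟩, by omega⟩
    have := card_le_card upper
    rw [← numNonzero, hcard, Int.card_Icc] at this
    omega
  have support : ((Icc (1 : ℤ) n).filter fun a => f a ≠ 0) = Icc (r : ℤ) n :=
    eq_of_subset_of_card_le support_subset (by rw [← numNonzero, hcard, Int.card_Icc]; omega)
  refine odd_ext hf.odd (fundWeight_isSignVector hr).odd fun a ha => ?_
  rcases lt_or_ge (n : ℤ) a with han | han
  · rw [hf.eq_zero a (lt_abs.2 (.inl han)),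
      (fundWeight_isSignVector hr).eq_zero a (lt_abs.2 (.inl han))]
  · have hsupp := Finset.ext_iff.1 support a
    rw [mem_filter, mem_Icc, mem_Icc] at hsupp
    have := nonneg a (by omega) han
    have := hf.bounds a
    unfold fundWeight
    split_ifs <;> omega

lemma exists_isMinRep (hr : 1 ≤ r) (hf : IsSignVector n f)
    (hcard : numNonzero n f = n + 1 - r) : ∃ σ, IsMinRep n r σ ∧ weight n r σ = f := by
  induction hk : inversions n f using Nat.strong_induction_on generalizing f with
  | _ k ih =>
    by_cases hmono : ∀ i ∈ Set.Icc (1 : ℤ) n, f (i - 1) ≤ f i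
    · exact ⟨1, isMinRep_one, (eq_fundWeight_of_monotone hr hf hcard hmono).symm⟩
    push Not at hmono
    obtain ⟨i, hi, hdesc⟩ := hmono
    have hinv := inversions_comp_simpleRefl_of_gt hf.odd hi hdesc
    have hcard' : numNonzero n (f ∘ simpleRefl i) = n + 1 - r :=
      (numNonzero_comp (simplePerm_mem hi.2) hf.odd).trans hcard
    obtain ⟨σ, hσ, hw⟩ := ih _ (by omega) (hf.comp_simpleRefl hi.2) hcard' rfl
    have hw' : weight n r (simplePerm i * σ) = f := by
      rw [weight_simplePerm_mul, hw]
      exact funext fun a => congrArg f (simpleRefl_simpleRefl i a)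
    refine ⟨simplePerm i * σ, hσ.simplePerm_mul hr hi.2 fun heq => hdesc.ne ?_, hw'⟩
    rw [hw] at heq
    exact (rel_comp_simpleRefl (R := (· = ·)) (by omega) hf.odd hi.1).1 heq

/-! ### Tail sums and sums of non-adjacent simple roots -/

/-- The sum of the coordinates from the `i`-th one on: up to a positive factor, the coefficient of
the simple root `α_i`. -/
def tailSum (n : ℕ) (f : ℤ → ℤ) (i : ℤ) : ℤ := ∑ k ∈ Icc i n, f k

lemma tailSum_of_gt (f : ℤ → ℤ) (hi : n < i) : tailSum n f i = 0 := by
  rw [tailSum, Icc_eq_empty (by omega), sum_empty]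

lemma tailSum_eq (f : ℤ → ℤ) (hi : i ≤ n) : tailSum n f i = f i + tailSum n f (i + 1) := by
  rw [tailSum, ← add_sum_Ioc_eq_sum_Icc hi, tailSum, ← Order.succ_eq_add_one,
    Finset.Icc_succ_left_eq_Ioc]

lemma tailSum_neg (n : ℕ) (f : ℤ → ℤ) (i : ℤ) : tailSum n (-f) i = -tailSum n f i :=
  sum_neg_distrib ..

lemma tailSum_comp_simpleRefl (f : ℤ → ℤ) (hi : i ∈ Set.Icc (1 : ℤ) n) {j : ℤ} (hj : 1 ≤ j) :
    tailSum n (f ∘ simpleRefl i) j =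
      tailSum n f j + if j = i then f (simpleRefl i i) - f i else 0 := by
  have hn := hi.2
  rcases lt_or_ge (n : ℤ) j with hjn | hjn
  · rw [tailSum_of_gt _ hjn, tailSum_of_gt _ hjn, if_neg (by omega), add_zero]
  induction j, hjn using Int.leInductionDown with
  | base =>
    simp only [tailSum_eq _ le_rfl, tailSum_of_gt _ (lt_add_one (n : ℤ)), Function.comp_apply]
    split_ifs with h
    · rw [h]; ring
    · rw [simpleRefl_of_ne (by omega) h (by omega)]; ring
  | pred j hjn ih =>
    rw [tailSum_eq _ (by omega), tailSum_eq f (by omega), sub_add_cancel, ih (by omega),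
      Function.comp_apply]
    by_cases h : j = i
    · rw [if_pos h, if_neg (by omega), h, simpleRefl_pred (by omega), simpleRefl_self (by omega)]
      ring
    rw [if_neg h]
    split_ifs with h'
    · rw [h']; ring
    · rw [simpleRefl_of_ne hj h' (by omega)]; ring

lemma eq_of_tailSum_eq (hf : IsSignVector n f) (hg : IsSignVector n g)
    (h : ∀ i, 1 ≤ i → tailSum n f i = tailSum n g i) : f = g := by
  refine odd_ext hf.odd hg.odd fun a ha => ?_
  rcases lt_or_ge (n : ℤ) a with han | han
  · rw [hf.eq_zero a (lt_abs.2 (.inl han)), hg.eq_zero a (lt_abs.2 (.inl han))]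
  · have := h a ha
    rw [tailSum_eq f han, tailSum_eq g han, h (a + 1) (by omega)] at this
    exact add_right_cancel this

/-- The increasing sequences in `[1, n]` with gaps at least `2`. -/
structure IsSparse (n : ℕ) (l : List ℤ) : Prop where
  mem : ∀ x ∈ l, x ∈ Set.Icc (1 : ℤ) n
  pairwise : l.Pairwise fun x y => x + 2 ≤ y

lemma IsSparse.nodup (hl : IsSparse n l) : l.Nodup :=
  hl.pairwise.imp fun h => by omega

lemma IsSparse.lt (hl : IsSparse n l) : l.Pairwise (· < ·) :=
  hl.pairwise.imp fun h => by omega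

lemma IsSparse.succ_notMem (hl : IsSparse n l) {x : ℤ} (hx : x ∈ l) : x + 1 ∉ l := fun hy => by
  have : Std.Symm fun x y : ℤ => x + 2 ≤ y ∨ y + 2 ≤ x := ⟨fun _ _ => Or.symm⟩
  have := (hl.pairwise.imp (S := fun x y => x + 2 ≤ y ∨ y + 2 ≤ x) Or.inl).forall hx hy (by omega)
  omega

lemma IsSparse.pred_notMem (hl : IsSparse n l) {x : ℤ} (hx : x ∈ l) : x - 1 ∉ l := fun hy =>
  hl.succ_notMem hy (by rwa [sub_add_cancel])

lemma IsSparse.mem_erase_one (hl : IsSparse n l) {p : ℤ} : p ∈ l.erase 1 ↔ 2 ≤ p ∧ p ∈ l := by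
  rw [hl.nodup.mem_erase_iff]
  refine and_congr_left fun hp => ?_
  have := (hl.mem p hp).1
  omega

/-- The coordinates of `∑ i ∈ l, (e i - e (i - 1))`. -/
def blockSum (l : List ℤ) (a : ℤ) : ℤ :=
  (if a ∈ l then 1 else 0) - (if a + 1 ∈ l then 1 else 0) + (if 1 - a ∈ l then 1 else 0) -
    if -a ∈ l then 1 else 0

lemma blockSum_odd (l : List ℤ) : (blockSum l).Odd := fun a => by
  rw [blockSum, blockSum, neg_neg, sub_neg_eq_add, neg_add_eq_sub, add_comm 1 a]
  ring

lemma IsSparse.blockSum_of_pos (hl : IsSparse n l) {a : ℤ} (ha : 1 ≤ a) :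
    blockSum l a = (if a ∈ l then 1 else 0) - if a + 1 ∈ l then 1 else 0 := by
  have h₁ : 1 - a ∉ l := fun h => by have := (hl.mem _ h).1; omega
  have h₂ : -a ∉ l := fun h => by have := (hl.mem _ h).1; omega
  rw [blockSum, if_neg h₁, if_neg h₂, add_zero, sub_zero]

lemma IsSparse.blockSum_isSignVector (hl : IsSparse n l) : IsSignVector n (blockSum l) where
  odd := blockSum_odd l
  bounds a := by
    have bounds_of_pos : ∀ a, 1 ≤ a → -1 ≤ blockSum l a ∧ blockSum l a ≤ 1 := fun a ha => by
      rw [hl.blockSum_of_pos ha]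
      split_ifs <;> omega
    rcases lt_trichotomy a 0 with ha | rfl | ha
    · have := bounds_of_pos (-a) (by omega)
      rw [blockSum_odd] at this
      omega
    · simp [(blockSum_odd l).map_zero]
    · exact bounds_of_pos a ha
  eq_zero a ha := by
    have zero_of_gt : ∀ a : ℤ, n < a → blockSum l a = 0 := fun a ha => by
      have h₁ : a ∉ l := fun h => by have := (hl.mem _ h).2; omega
      have h₂ : a + 1 ∉ l := fun h => by have := (hl.mem _ h).2; omega
      rw [hl.blockSum_of_pos (by omega), if_neg h₁, if_neg h₂, sub_zero]
    rcases lt_abs.1 ha with h | h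
    · exact zero_of_gt a h
    · rw [← neg_eq_zero, ← blockSum_odd, zero_of_gt _ h]

lemma IsSparse.tailSum_blockSum (hl : IsSparse n l) {j : ℤ} (hj : 1 ≤ j) :
    tailSum n (blockSum l) j = if j ∈ l then 1 else 0 := by
  have notMem_of_gt : ∀ {j : ℤ}, n < j → j ∉ l := fun hj h => by
    have := (hl.mem _ h).2
    omega
  rcases lt_or_ge (n : ℤ) j with hjn | hjn
  · rw [tailSum_of_gt _ hjn, if_neg (notMem_of_gt hjn)]
  induction j, hjn using Int.leInductionDown with
  | base =>
    rw [tailSum_eq _ le_rfl, tailSum_of_gt _ (lt_add_one _), hl.blockSum_of_pos hj,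
      if_neg (notMem_of_gt (lt_add_one _)), sub_zero, add_zero]
  | pred j hjn ih =>
    rw [tailSum_eq _ (by omega), hl.blockSum_of_pos hj, sub_add_cancel, ih (by omega),
      sub_add_cancel]

lemma IsSparse.blockSum_ne_zero_iff (hl : IsSparse n l) {a : ℤ} (ha : 1 ≤ a) :
    blockSum l a ≠ 0 ↔ a ∈ l ∨ a + 1 ∈ l := by
  rw [hl.blockSum_of_pos ha]
  by_cases h : a ∈ l
  · simp [h, hl.succ_notMem h]
  · simp [h]

lemma IsSparse.blockSum_eq_one_iff (hl : IsSparse n l) {p : ℤ} :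
    blockSum l p = 1 ↔ p ∈ l ∨ 1 - p ∈ l.erase 1 := by
  rw [hl.mem_erase_one]
  rcases lt_or_ge 0 p with hp | hp
  · have : p ∈ l → p + 1 ∉ l := hl.succ_notMem
    rw [hl.blockSum_of_pos hp]
    split_ifs <;> grind
  · obtain ⟨q, rfl⟩ := neg_surjective p
    have notMem : -q ∉ l := fun h => by have := (hl.mem _ h).1; omega
    have : q ∈ l → q + 1 ∉ l := hl.succ_notMem
    rcases eq_or_lt_of_le (neg_nonpos.1 hp) with rfl | hq
    · rw [neg_zero] at notMem ⊢
      simp [(blockSum_odd l).map_zero, notMem]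
    rw [blockSum_odd, hl.blockSum_of_pos hq]
    split_ifs <;> grind

lemma IsSparse.numNonzero_blockSum (hl : IsSparse n l) :
    numNonzero n (blockSum l) + (if (1 : ℤ) ∈ l then 1 else 0) = 2 * l.length := by
  have support : (Icc (1 : ℤ) n).filter (fun a => blockSum l a ≠ 0) =
      (l.toFinset ∪ l.toFinset.image (· - 1)).erase 0 := by
    ext a
    simp only [mem_filter, mem_erase, mem_union, mem_image, List.mem_toFinset, sub_eq_iff_eq_add,
      exists_eq_right]
    constructor
    · rintro ⟨ha, hne⟩
      have := (mem_Icc.1 ha).1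
      exact ⟨by omega, (hl.blockSum_ne_zero_iff this).1 hne⟩
    · rintro ⟨h₀, h⟩
      have ha : 1 ≤ a ∧ a ≤ n := by
        rcases h with h | h <;> have := hl.mem _ h <;> rw [Set.mem_Icc] at this <;> omega
      exact ⟨mem_Icc.2 ha, (hl.blockSum_ne_zero_iff ha.1).2 h⟩
  have hdisj : Disjoint l.toFinset (l.toFinset.image (· - 1)) := disjoint_right.2 fun a ha h => by
    obtain ⟨b, hb, rfl⟩ := mem_image.1 ha
    exact hl.pred_notMem (List.mem_toFinset.1 hb) (List.mem_toFinset.1 h)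
  have hcard : (l.toFinset ∪ l.toFinset.image (· - 1)).card = 2 * l.length := by
    rw [card_union_of_disjoint hdisj, card_image_of_injective _ (sub_left_injective),
      List.toFinset_card_of_nodup hl.nodup, two_mul]
  have hzero : (0 : ℤ) ∈ l.toFinset ∪ l.toFinset.image (· - 1) ↔ (1 : ℤ) ∈ l := by
    have : (0 : ℤ) ∉ l := fun h => absurd (hl.mem _ h).1 (by norm_num)
    simp [this, sub_eq_zero]
  rw [numNonzero, support, card_erase_eq_ite, hcard]
  simp only [hzero]
  split_ifs with h
  · have := List.length_pos_of_mem h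
    omega
  · rfl

/-- The hypothesis `htail` describes `blockSum L` with the signs of the blocks in `l` reversed. -/
lemma IsSparse.values_at_block (hL : IsSparse n L) (hf : f.Odd)
    (htail : ∀ j, 1 ≤ j → tailSum n f j = (if j ∈ L then 1 else 0) - 2 * if j ∈ l then 1 else 0)
    (hl : l ⊆ L) (hi : i ∈ L) (hil : i ∉ l) :
    f i = 1 ∧ f (simpleRefl i i) = -1 ∧ f (i - 1) < f i := by
  obtain ⟨h₁, hn⟩ := hL.mem i hi
  have value : f i = 1 := by
    have h := htail i h₁
    rw [tailSum_eq _ hn, htail (i + 1) (by omega), if_pos hi, if_neg hil,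
      if_neg (hL.succ_notMem hi), if_neg fun h => hL.succ_notMem hi (hl h)] at h
    omega
  rcases eq_or_lt_of_le h₁ with rfl | h₂
  · rw [simpleRefl_one_one, hf, sub_self, hf.map_zero, value]
    norm_num
  · have value_pred : f (i - 1) = -1 := by
      have h := htail (i - 1) (by omega)
      rw [tailSum_eq _ (by omega), sub_add_cancel, htail i h₁, if_pos hi, if_neg hil,
        if_neg (hL.pred_notMem hi), if_neg fun h => hL.pred_notMem hi (hl h)] at h
      omega
    rw [simpleRefl_self h₂, value_pred, value]
    norm_num

/-- The reflections `s_i` with `i ∈ L` act independently on a sum of non-adjacent blocks: each one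
reverses the sign of its own block and adds one inversion. -/
lemma IsMinRep.flip_blocks (hσ : IsMinRep n r σ) (hr : 1 ≤ r) (hL : IsSparse n L)
    (hw : weight n r σ = blockSum L) (hl : l ⊆ L) (hnodup : l.Nodup) :
    IsMinRep n r (wordPerm l * σ) ∧ inversions n (wordPerm l * σ : Equiv.Perm ℤ) =
      inversions n σ + l.length ∧
      ∀ j, 1 ≤ j → tailSum n (weight n r (wordPerm l * σ)) j =
        (if j ∈ L then 1 else 0) - 2 * if j ∈ l then 1 else 0 := by
  induction l with
  | nil => exact ⟨hσ, rfl, fun j hj => by simp [wordPerm, hw, hL.tailSum_blockSum hj]⟩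
  | cons i l ih =>
    obtain ⟨hi, hl⟩ := List.cons_subset.1 hl
    obtain ⟨hil, hnodup⟩ := List.nodup_cons.1 hnodup
    obtain ⟨hmin, hinv, htail⟩ := ih hl hnodup
    have hmem := hL.mem i hi
    have hodd := (weight_isSignVector hr hmin.1).odd
    obtain ⟨value, value_refl, ascent⟩ := hL.values_at_block hodd htail hl hi hil
    have hmin' := hmin.simplePerm_mul hr hmem.2 ascent.ne
    rw [wordPerm_cons, mul_assoc]
    refine ⟨hmin', ?_, fun j hj => ?_⟩
    · rw [hmin'.inversions_eq hr, weight_simplePerm_mul,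
        inversions_comp_simpleRefl_of_lt hodd hmem ascent, ← hmin.inversions_eq hr, hinv,
        List.length_cons, add_assoc]
    · rw [weight_simplePerm_mul, tailSum_comp_simpleRefl _ hmem hj, htail j hj, value,
        value_refl]
      by_cases h : j = i
      · subst h; simp [hil, sub_eq_add_neg]
      · simp [h]

lemma IsMinRep.wordPerm_mul (hσ : IsMinRep n r σ) (hr : 1 ≤ r) (hl : IsSparse n l)
    (hw : weight n r σ = blockSum l) : IsMinRep n r (wordPerm l * σ) :=
  (hσ.flip_blocks hr hl hw (List.Subset.refl l) hl.nodup).1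

lemma IsMinRep.weight_wordPerm_mul (hσ : IsMinRep n r σ) (hr : 1 ≤ r) (hl : IsSparse n l)
    (hw : weight n r σ = blockSum l) : weight n r (wordPerm l * σ) = -blockSum l := by
  obtain ⟨hmin, -, htail⟩ := hσ.flip_blocks hr hl hw (List.Subset.refl l) hl.nodup
  refine eq_of_tailSum_eq (weight_isSignVector hr hmin.1) hl.blockSum_isSignVector.neg
    fun j hj => ?_
  rw [htail j hj, tailSum_neg, hl.tailSum_blockSum hj]
  ring

lemma IsMinRep.two_mul_inversions (hτ : IsMinRep n r τ) (hr : 1 ≤ r) (hl : IsSparse n l)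
    (hw : weight n r τ = -blockSum l) :
    2 * inversions n τ = distinctPairs n (fundWeight n r) + l.length := by
  have hcard : numNonzero n (blockSum l) = n + 1 - r := by
    rw [← numNonzero_neg, ← hw, numNonzero_weight hr hτ.1]
  obtain ⟨σ, hσ, hwσ⟩ := exists_isMinRep hr hl.blockSum_isSignVector hcard
  obtain ⟨hmin, hinv, -⟩ := hσ.flip_blocks hr hl hwσ (List.Subset.refl l) hl.nodup
  have heq := hmin.eq_of_weight_eq hτ hr ((hσ.weight_wordPerm_mul hr hl hwσ).trans hw.symm)
  have hsum := inversions_add_inversions_neg n (weight n r τ)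
  rw [← hτ.inversions_eq hr, hw, neg_neg, ← hwσ, ← hσ.inversions_eq hr, hwσ, ← hw, weight,
    distinctPairs_comp (inv_mem hτ.1) (fundWeight_isSignVector hr).odd] at hsum
  rw [heq] at hinv
  omega

/-! ### Lowering a nonpositive weight -/

/-- The integer form of nonpositivity in the dominance order. -/
def IsTailNonpos (n : ℕ) (f : ℤ → ℤ) : Prop := ∀ i ∈ Set.Icc (1 : ℤ) n, tailSum n f i ≤ 0

/-- No simple reflection both decreases the number of inversions of `f` and keeps `f` nonpositive
in the dominance order. -/
def IsUnlowerable (n : ℕ) (f : ℤ → ℤ) : Prop :=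
  ∀ i ∈ Set.Icc (1 : ℤ) n, f i < f (i - 1) → ¬IsTailNonpos n (f ∘ simpleRefl i)

lemma IsUnlowerable.tailSum_pos (h : IsUnlowerable n f) (hf : IsTailNonpos n f)
    (hi : i ∈ Set.Icc (1 : ℤ) n) (hdesc : f i < f (i - 1)) :
    0 < tailSum n f i + (f (simpleRefl i i) - f i) := by
  by_contra! hle
  refine h i hi hdesc fun j hj => ?_
  rw [tailSum_comp_simpleRefl f hi hj.1]
  split_ifs with hji
  · rwa [hji]
  · simpa using hf j hj

lemma IsTailNonpos.le (hf : IsTailNonpos n f) (hi : 1 ≤ i) : tailSum n f i ≤ 0 := by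
  rcases le_or_gt i n with hn | hn
  · exact hf i ⟨hi, hn⟩
  · exact (tailSum_of_gt f hn).le

lemma IsUnlowerable.tailSum_eq_of_neg (h : IsUnlowerable n f) (hf : IsTailNonpos n f)
    (hsign : IsSignVector n f) (hi : i ∈ Set.Icc (1 : ℤ) n) (hfi : f i < 0) :
    tailSum n f i = -1 ∧ tailSum n f (i + 1) = 0 := by
  obtain ⟨h₁, hn⟩ := hi
  induction i, h₁ using Int.leInduction with
  | base =>
    have hpos := h.tailSum_pos hf ⟨le_rfl, hn⟩ (by simpa [hsign.odd.map_zero] using hfi)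
    rw [simpleRefl_one_one, hsign.odd] at hpos
    have := tailSum_eq f hn
    have := hf.le (i := 1 + 1) (by norm_num)
    have := hsign.bounds 1
    omega
  | succ i h₁ ih =>
    have hT := tailSum_eq f hn
    have hT' := tailSum_eq f (show i ≤ n by omega)
    have := hf.le h₁
    have := hf.le (show 1 ≤ i + 1 + 1 by omega)
    have := hsign.bounds (i + 1)
    have := hsign.bounds i
    rcases lt_or_ge (f i) 0 with hneg | hnonneg
    · have := (ih hneg (by omega)).2
      omega
    · have hpos := h.tailSum_pos hf (i := i + 1) ⟨by omega, hn⟩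
        (by rw [add_sub_cancel_right]; omega)
      rw [simpleRefl_self (by omega), add_sub_cancel_right] at hpos
      omega

lemma IsUnlowerable.neg_one_le_tailSum (h : IsUnlowerable n f) (hf : IsTailNonpos n f)
    (hsign : IsSignVector n f) (hi : i ∈ Set.Icc (1 : ℤ) n) :
    -1 ≤ tailSum n f i ∧ (tailSum n f i = -1 → tailSum n f (i + 1) = 0) := by
  obtain ⟨h₁, hn⟩ := hi
  induction i, hn using Int.leInductionDown with
  | base =>
    have := tailSum_eq f (le_refl (n : ℤ))
    have := tailSum_of_gt f (lt_add_one (n : ℤ))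
    have := hsign.bounds n
    omega
  | pred i hn ih =>
    obtain ⟨ih, ih'⟩ := ih (by omega)
    have hT := tailSum_eq f hn
    have hT' := tailSum_eq f (show i - 1 ≤ n by omega)
    rw [sub_add_cancel] at hT' ⊢
    rcases lt_or_ge (f (i - 1)) 0 with hneg | hnonneg
    · have := h.tailSum_eq_of_neg hf hsign ⟨h₁, by omega⟩ hneg
      rw [sub_add_cancel] at this
      omega
    refine ⟨by omega, fun heq => ?_⟩
    by_contra hne
    have := hf.le (show 1 ≤ i by omega)
    have hpos := h.tailSum_pos hf (i := i) ⟨by omega, hn⟩ (by omega)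
    rw [simpleRefl_self (by omega)] at hpos
    omega

lemma IsUnlowerable.exists_eq_neg_blockSum (h : IsUnlowerable n f) (hf : IsTailNonpos n f)
    (hsign : IsSignVector n f) : ∃ l, IsSparse n l ∧ f = -blockSum l := by
  set S := (Icc (1 : ℤ) n).filter fun i => tailSum n f i = -1 with hS
  have mem_sort : ∀ {i}, i ∈ S.sort (· ≤ ·) ↔ (1 ≤ i ∧ i ≤ n) ∧ tailSum n f i = -1 := fun {i} => by
    rw [Finset.mem_sort, hS, mem_filter, mem_Icc]
  have hsparse : IsSparse n (S.sort (· ≤ ·)) := by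
    refine ⟨fun i hi => (mem_sort.1 hi).1, ?_⟩
    refine (S.sortedLT_sort).pairwise.imp_of_mem fun {i j} hi hj hij => ?_
    have := (h.neg_one_le_tailSum hf hsign (mem_sort.1 hi).1).2 (mem_sort.1 hi).2
    have hne : j ≠ i + 1 := by
      rintro rfl
      have := (mem_sort.1 hj).2
      omega
    omega
  refine ⟨_, hsparse, eq_of_tailSum_eq hsign hsparse.blockSum_isSignVector.neg fun i hi => ?_⟩
  rw [tailSum_neg, hsparse.tailSum_blockSum hi]
  rcases lt_or_ge (n : ℤ) i with hn | hn
  · rw [tailSum_of_gt f hn, if_neg fun hmem => ?_, neg_zero]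
    have := (mem_sort.1 hmem).1
    omega
  · have := (h.neg_one_le_tailSum hf hsign ⟨hi, hn⟩).1
    have := hf.le hi
    simp only [mem_sort]
    split_ifs <;> omega

lemma IsMinRep.eq_neg_blockSum_or_exists_lower (hσ : IsMinRep n r σ) (hr : 1 ≤ r)
    (hneg : IsTailNonpos n (weight n r σ)) :
    (∃ l, IsSparse n l ∧ weight n r σ = -blockSum l) ∨
      ∃ i ∈ Set.Icc (1 : ℤ) n, IsMinRep n r (simplePerm i * σ) ∧
        IsTailNonpos n (weight n r (simplePerm i * σ)) ∧
        inversions n (simplePerm i * σ : Equiv.Perm ℤ) + 1 = inversions n σ := by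
  have hsign := weight_isSignVector hr hσ.1
  by_cases h : IsUnlowerable n (weight n r σ)
  · exact .inl (h.exists_eq_neg_blockSum hneg hsign)
  unfold IsUnlowerable at h
  push Not at h
  obtain ⟨i, hi, hdesc, hneg'⟩ := h
  have hmin := hσ.simplePerm_mul hr hi.2 hdesc.ne'
  rw [← weight_simplePerm_mul] at hneg'
  refine .inr ⟨i, hi, hmin, hneg', ?_⟩
  rw [hmin.inversions_eq hr, weight_simplePerm_mul,
    inversions_comp_simpleRefl_of_gt hsign.odd hi hdesc, hσ.inversions_eq hr]

/-! ### One-line notation -/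

lemma IsMinRep.inv_pos_iff (hσ : IsMinRep n r σ) (hr : 1 ≤ r) {p : ℤ} (hp : |p| ≤ n) :
    0 < σ⁻¹ p ↔ 0 < weight n r σ p ∨ weight n r σ p = 0 ∧ 0 < p := by
  have h := hσ.inv_lt_inv_iff hr (p := 0) (by simp) hp
  rw [map_zero_of_mem (inv_mem hσ.1), (weight_isSignVector hr hσ.1).odd.map_zero] at h
  rw [h, eq_comm (a := (0 : ℤ))]

lemma mem_ofFn_iff (hσ : σ ∈ signedPerms n) {p : ℤ} :
    p ∈ List.ofFn (fun j : Fin n => σ (j + 1)) ↔ |p| ≤ n ∧ 0 < σ⁻¹ p := by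
  rw [List.mem_ofFn]
  constructor
  · rintro ⟨j, rfl⟩
    refine ⟨abs_map_le hσ (abs_le.2 ⟨by omega, by omega⟩), ?_⟩
    rw [Equiv.Perm.coe_inv, Equiv.symm_apply_apply]
    omega
  · rintro ⟨hp, hpos⟩
    have := (abs_le.1 (abs_map_le (inv_mem hσ) hp)).2
    refine ⟨⟨(σ⁻¹ p - 1).toNat, by omega⟩, ?_⟩
    dsimp only
    rw [Int.toNat_of_nonneg (by omega), sub_add_cancel, Equiv.Perm.coe_inv,
      Equiv.apply_symm_apply]

/-- The values `σ 1, …, σ n` are the indices of weight `0` followed by those of weight `1`. -/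
lemma IsMinRep.ofFn_eq_append (hσ : IsMinRep n r σ) (hr : 1 ≤ r) {A B : List ℤ}
    (hA : A.Pairwise (· < ·)) (hB : B.Pairwise (· < ·))
    (memA : ∀ p, p ∈ A ↔ (1 ≤ p ∧ p ≤ n) ∧ weight n r σ p = 0)
    (memB : ∀ p, p ∈ B ↔ weight n r σ p = 1) :
    List.ofFn (fun j : Fin n => σ (j + 1)) = A ++ B := by
  have hsign := weight_isSignVector hr hσ.1
  have abs_le_of_memA : ∀ p ∈ A, |p| ≤ n := fun p hp => by
    have := ((memA p).1 hp).1
    exact abs_le.2 ⟨by omega, this.2⟩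
  have abs_le_of_memB : ∀ p ∈ B, |p| ≤ n := fun p hp => by
    by_contra! hlt
    exact absurd ((memB p).1 hp) (by rw [hsign.eq_zero p hlt]; norm_num)
  have : Std.Asymm fun p q => σ⁻¹ p < σ⁻¹ q := ⟨fun _ _ => lt_asymm⟩
  refine List.Pairwise.eq_of_mem_iff (r := fun p q => σ⁻¹ p < σ⁻¹ q) ?_ ?_ fun p => ?_
  · refine List.pairwise_ofFn.2 fun hab => ?_
    simp only [Equiv.Perm.coe_inv, Equiv.symm_apply_apply]
    omega
  · refine List.pairwise_append.2 ⟨hA.imp_of_mem fun {p q} hp hq hpq => ?_,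
      hB.imp_of_mem fun {p q} hp hq hpq => ?_, fun p hp q hq => ?_⟩
    · rw [hσ.inv_lt_inv_iff hr (abs_le_of_memA p hp) (abs_le_of_memA q hq)]
      exact .inr ⟨((memA p).1 hp).2.trans ((memA q).1 hq).2.symm, hpq⟩
    · rw [hσ.inv_lt_inv_iff hr (abs_le_of_memB p hp) (abs_le_of_memB q hq)]
      exact .inr ⟨((memB p).1 hp).trans ((memB q).1 hq).symm, hpq⟩
    · rw [hσ.inv_lt_inv_iff hr (abs_le_of_memA p hp) (abs_le_of_memB q hq), (memB q).1 hq,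
        ((memA p).1 hp).2]
      exact .inl one_pos
  · have hone := hsign.bounds p
    rw [mem_ofFn_iff hσ.1, List.mem_append]
    by_cases hp : |p| ≤ n
    · have := (abs_le.1 hp).2
      rw [hσ.inv_pos_iff hr hp, memA, memB]
      omega
    · exact iff_of_false (fun h => hp h.1) fun h =>
        hp (h.elim (abs_le_of_memA p) (abs_le_of_memB p))

end

end SignedPerm

namespace BCType

open Finset SignedPerm

noncomputable section

section SignedPermutations

variable {t : BCType} {n r : ℕ} {i : ℤ} {f : ℤ → ℤ} {l l' : List ℤ} {ω : V n}
  {w w' : V n ≃ₗᵢ[ℝ] V n}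
  {σ τ : Equiv.Perm ℤ}

/-! ### Vectors and their coordinates -/

lemma e_neg (n : ℕ) (a : ℤ) : e n (-a) = -e n a := by
  ext k
  simp only [e, PiLp.neg_apply]
  split_ifs <;> first | omega | norm_num

lemma e_zero (n : ℕ) : e n 0 = 0 := by
  ext k
  simp only [e, PiLp.zero_apply]
  rw [if_neg (by omega), if_neg (by omega)]

lemma e_succ (k : Fin n) : e n ((k : ℤ) + 1) = EuclideanSpace.single k 1 := by
  ext j
  simp only [e, PiLp.single_apply, Fin.ext_iff]
  split_ifs <;> first | omega | rfl

lemma inner_e_succ (k : Fin n) (v : V n) : inner ℝ (e n ((k : ℤ) + 1)) v = v k := by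
  rw [e_succ, EuclideanSpace.inner_single_left, map_one, one_mul]

lemma ext_inner_e {v v' : V n}
    (h : ∀ a ∈ Set.Icc (1 : ℤ) n, inner ℝ (e n a) v = inner ℝ (e n a) v') : v = v' := by
  ext k
  rw [← inner_e_succ, ← inner_e_succ]
  exact h _ ⟨by omega, by omega⟩

lemma inner_e_e {a : ℤ} (ha : a ∈ Set.Icc (1 : ℤ) n) (b : ℤ) :
    inner ℝ (e n a) (e n b) = (if a = b then (1 : ℝ) else 0) - if a = -b then 1 else 0 := by
  obtain ⟨k, rfl⟩ : ∃ k : Fin n, (k : ℤ) + 1 = a :=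
    ⟨⟨(a - 1).toNat, by grind⟩, by grind⟩
  rw [inner_e_succ, e]
  dsimp only
  split_ifs <;> first | omega | norm_num

/-- The integral vector whose `a`-th coordinate is `f a`. -/
def vec (n : ℕ) (f : ℤ → ℤ) : V n := ∑ k ∈ Icc (1 : ℤ) n, (f k : ℝ) • e n k

lemma vec_neg (n : ℕ) (f : ℤ → ℤ) : vec n (-f) = -vec n f := by
  simp only [vec, Pi.neg_apply, Int.cast_neg, neg_smul, sum_neg_distrib]

lemma inner_e_vec (hf : f.Odd) {a : ℤ} (ha : |a| ≤ n) : inner ℝ (e n a) (vec n f) = f a := by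
  have pos : ∀ a ∈ Set.Icc (1 : ℤ) n, inner ℝ (e n a) (vec n f) = f a := by
    rintro a ⟨h₁, hn⟩
    rw [vec, inner_sum, sum_eq_single_of_mem a (mem_Icc.2 ⟨h₁, hn⟩), inner_smul_right,
      inner_e_e ⟨h₁, hn⟩, if_pos rfl, if_neg (by omega), sub_zero, mul_one]
    intro k hk hka
    have := (mem_Icc.1 hk).1
    rw [inner_smul_right, inner_e_e ⟨h₁, hn⟩, if_neg hka.symm, if_neg (by omega), sub_zero,
      mul_zero]
  rw [abs_le] at ha
  rcases lt_trichotomy a 0 with h | rfl | h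
  · obtain ⟨a, rfl⟩ := neg_surjective a
    rw [e_neg, inner_neg_left, pos a ⟨by omega, by omega⟩, hf, Int.cast_neg]
  · rw [e_zero, inner_zero_left, hf.map_zero, Int.cast_zero]
  · exact pos a ⟨by omega, ha.2⟩

lemma e_injOn (n : ℕ) : Set.InjOn (e n) {a | |a| ≤ n} := fun a ha b hb h => by
  have hid : Function.Odd (id : ℤ → ℤ) := fun _ => rfl
  have := inner_e_vec hid ha
  rw [h, inner_e_vec hid hb] at this
  exact_mod_cast this.symm

/-! ### The Weyl group as the group of signed permutations -/

/-- The isometry `w` permutes the vectors `e a` as the signed permutation `σ` permutes their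
indices. -/
def ActsAs (n : ℕ) (w : V n ≃ₗᵢ[ℝ] V n) (σ : Equiv.Perm ℤ) : Prop :=
  σ ∈ signedPerms n ∧ ∀ a, w (e n a) = e n (σ a)

lemma ActsAs.one (n : ℕ) : ActsAs n 1 1 := ⟨one_mem _, fun _ => rfl⟩

lemma ActsAs.mul (h : ActsAs n w σ) (h' : ActsAs n w' τ) : ActsAs n (w * w') (σ * τ) :=
  ⟨mul_mem h.1 h'.1, fun a => (congrArg w (h'.2 a)).trans (h.2 (τ a))⟩

lemma ActsAs.inv (h : ActsAs n w σ) : ActsAs n w⁻¹ σ⁻¹ :=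
  ⟨inv_mem h.1, fun a => w.injective <| by
    rw [h.2, Equiv.Perm.coe_inv, Equiv.apply_symm_apply]
    exact w.apply_symm_apply _⟩

lemma ActsAs.left_unique (h : ActsAs n w σ) (h' : ActsAs n w' σ) : w = w' := by
  refine LinearIsometryEquiv.toLinearEquiv_injective (LinearEquiv.toLinearMap_injective ?_)
  refine (EuclideanSpace.basisFun (Fin n) ℝ).toBasis.ext fun k => ?_
  simp only [OrthonormalBasis.coe_toBasis, EuclideanSpace.basisFun_apply, ← e_succ]
  exact (h.2 _).trans (h'.2 _).symm

lemma ActsAs.right_unique (h : ActsAs n w σ) (h' : ActsAs n w τ) : σ = τ := by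
  ext a
  rcases lt_or_ge (n : ℤ) |a| with ha | ha
  · rw [h.1.2 a ha, h'.1.2 a ha]
  · exact e_injOn n (abs_map_le h.1 ha) (abs_map_le h'.1 ha) ((h.2 a).symm.trans (h'.2 a))

lemma ActsAs.map_vec (h : ActsAs n w σ) (hf : f.Odd) :
    w (vec n f) = vec n (f ∘ (σ⁻¹ : Equiv.Perm ℤ)) := by
  have hσ := inv_mem h.1
  refine ext_inner_e fun a ha => ?_
  have ha : |a| ≤ n := abs_le.2 ⟨by grind, ha.2⟩
  have hwa : e n a = w (e n (σ⁻¹ a)) := by rw [h.2, Equiv.Perm.coe_inv, Equiv.apply_symm_apply]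
  rw [inner_e_vec (odd_comp hf (odd_of_mem hσ)) ha, hwa, LinearIsometryEquiv.inner_map_map,
    inner_e_vec hf (abs_map_le hσ ha), Function.comp_apply]

/-- The factor by which the simple root `α_i` differs from `e i - e (i - 1)`. -/
def rootScale (t : BCType) (i : ℤ) : ℝ := if i = 1 then t.specialLength else 1

lemma specialLength_pos (t : BCType) : 0 < t.specialLength := by
  cases t <;> norm_num [specialLength]

lemma rootScale_pos (t : BCType) (i : ℤ) : 0 < rootScale t i := by
  unfold rootScale
  split_ifs
  exacts [specialLength_pos t, one_pos]

lemma simpleRoot_eq (t : BCType) (n : ℕ) (i : ℤ) :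
    simpleRoot t n i = rootScale t i • (e n i - e n (i - 1)) := by
  unfold simpleRoot rootScale
  split_ifs with h
  · rw [h, sub_self, e_zero, sub_zero]
  · rw [one_smul]

lemma s_eq_refl (t : BCType) (n : ℕ) (i : ℤ) : s t n i = refl n (e n i - e n (i - 1)) := by
  simp only [s, simpleRoot_eq, refl,
    Submodule.span_singleton_smul_eq (rootScale_pos t i).ne'.isUnit]

lemma refl_of_inner_eq_zero {β v : V n} (h : inner ℝ β v = 0) : refl n β v = v :=
  Submodule.reflection_mem_subspace_eq_self (Submodule.mem_orthogonal_singleton_iff_inner_right.2 h)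

lemma s_e_self (t : BCType) (hi : i ∈ Set.Icc (2 : ℤ) n) : s t n i (e n i) = e n (i - 1) := by
  obtain ⟨h₂, hn⟩ := hi
  have norm_e : ∀ a ∈ Set.Icc (1 : ℤ) n, ‖e n a‖ = 1 := fun a ha => by
    have := ha.1
    rw [← sq_eq_sq₀ (norm_nonneg _) zero_le_one, ← real_inner_self_eq_norm_sq, inner_e_e ha,
      if_pos rfl, if_neg (by omega), sub_zero, one_pow]
  rw [s_eq_refl]
  exact Submodule.reflection_sub <|
    (norm_e i ⟨by omega, hn⟩).trans (norm_e (i - 1) ⟨by omega, by omega⟩).symm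

lemma s_e_of_ne (t : BCType) (hi : i ∈ Set.Icc (1 : ℤ) n) {a : ℤ} (ha : 1 ≤ a) (h₁ : a ≠ i)
    (h₂ : a ≠ i - 1) : s t n i (e n a) = e n a := by
  have := hi.1
  rw [s_eq_refl]
  refine refl_of_inner_eq_zero ?_
  rw [inner_sub_left, inner_e_e hi, if_neg h₁.symm, if_neg (by omega), sub_zero, zero_sub,
    neg_eq_zero]
  rcases eq_or_ne i 1 with rfl | hi₁
  · rw [sub_self, e_zero, inner_zero_left]
  · have := hi.2
    rw [inner_e_e ⟨by omega, by omega⟩, if_neg h₂.symm, if_neg (by omega), sub_zero]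

lemma s_e_of_pos (t : BCType) (hi : i ∈ Set.Icc (1 : ℤ) n) {a : ℤ} (ha : 1 ≤ a) :
    s t n i (e n a) = e n (simpleRefl i a) := by
  by_cases hne : a ≠ i ∧ a ≠ i - 1
  · rw [simpleRefl_of_ne ha hne.1 hne.2, s_e_of_ne t hi ha hne.1 hne.2]
  rcases eq_or_lt_of_le hi.1 with rfl | h₂
  · obtain rfl : a = 1 := by omega
    rw [simpleRefl_one_one, e_neg, s_eq_refl, sub_self, e_zero, sub_zero]
    exact Submodule.reflection_orthogonalComplement_singleton_eq_neg _
  have hself := s_e_self t ⟨h₂, hi.2⟩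
  obtain rfl | rfl : a = i ∨ a = i - 1 := by omega
  · rw [simpleRefl_self h₂, hself]
  · rw [simpleRefl_pred h₂, ← hself]
    exact Submodule.reflection_reflection _ _

lemma actsAs_s (t : BCType) (hi : i ∈ Set.Icc (1 : ℤ) n) : ActsAs n (s t n i) (simplePerm i) := by
  refine ⟨simplePerm_mem hi.2, fun a => ?_⟩
  rw [simplePerm_apply]
  rcases lt_trichotomy a 0 with ha | rfl | ha
  · obtain ⟨a, rfl⟩ := neg_surjective a
    rw [e_neg, map_neg, s_e_of_pos t hi (by omega), simpleRefl_odd, e_neg]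
  · rw [(simpleRefl_odd i).map_zero, e_zero, map_zero]
  · exact s_e_of_pos t hi ha

lemma actsAs_wordProd (t : BCType) (hl : ∀ i ∈ l, i ∈ Set.Icc (1 : ℤ) n) :
    ActsAs n (wordProd t n l) (wordPerm l) := by
  induction l with
  | nil => exact ActsAs.one n
  | cons i l ih =>
    rw [List.forall_mem_cons] at hl
    rw [wordPerm_cons, wordProd, List.map_cons, List.prod_cons]
    exact (actsAs_s t hl.1).mul (ih hl.2)

lemma exists_actsAs (hw : w ∈ weylGroup t n) : ∃ σ, ActsAs n w σ := by
  induction hw using Subgroup.closure_induction with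
  | mem w hw =>
    obtain ⟨i, hi, rfl⟩ := hw
    exact ⟨_, actsAs_s t hi⟩
  | one => exact ⟨1, ActsAs.one n⟩
  | mul w w' _ _ hw hw' =>
    obtain ⟨⟨σ, hσ⟩, ⟨τ, hτ⟩⟩ := And.intro hw hw'
    exact ⟨_, hσ.mul hτ⟩
  | inv w _ hw => exact hw.imp' _ fun σ hσ => hσ.inv

lemma exists_actsAs_of_mem_signedPerms (t : BCType) (hσ : σ ∈ signedPerms n) :
    ∃ w ∈ weylGroup t n, ActsAs n w σ := by
  obtain ⟨l, hl, -, rfl⟩ := exists_wordPerm_eq hσ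
  refine ⟨_, Subgroup.list_prod_mem _ fun w hw => ?_, actsAs_wordProd t hl⟩
  obtain ⟨i, hi, rfl⟩ := List.mem_map.1 hw
  exact Subgroup.subset_closure ⟨i, hl i hi, rfl⟩

lemma ActsAs.mem_weylGroup (t : BCType) (h : ActsAs n w σ) : w ∈ weylGroup t n := by
  obtain ⟨w', hw', h'⟩ := exists_actsAs_of_mem_signedPerms t h.1
  rwa [h.left_unique h']

lemma ActsAs.length_eq (t : BCType) (h : ActsAs n w σ) : length t n w = inversions n σ := by
  obtain ⟨l, hl, hlen_inv, hw_inv⟩ := exists_wordPerm_eq h.1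
  have hmem : inversions n σ ∈ {k | ∃ l : List ℤ, (∀ i ∈ l, i ∈ Set.Icc (1 : ℤ) n) ∧
      l.length = k ∧ wordProd t n l = w} :=
    ⟨l, hl, hlen_inv, (actsAs_wordProd t hl).left_unique (hw_inv ▸ h)⟩
  refine le_antisymm (Nat.sInf_le hmem) ?_
  obtain ⟨word, hword, hlen, hw⟩ := Nat.sInf_mem ⟨_, hmem⟩
  have hσ : σ = wordPerm word := h.right_unique (hw ▸ actsAs_wordProd t hword)
  rw [length, ← hlen, hσ]
  exact inversions_wordPerm_le hword

/-! ### Positive roots and dominance -/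

/-- The vector `e i + ⋯ + e n`; for `1 ≤ i ≤ n` the inner product with it is a positive multiple of
the coefficient of `α_i`. -/
def tailVec (n : ℕ) (i : ℤ) : V n := ∑ k ∈ Icc i n, e n k

lemma inner_tailVec_vec (hf : f.Odd) (hi : 1 ≤ i) :
    inner ℝ (tailVec n i) (vec n f) = tailSum n f i := by
  rw [tailVec, sum_inner, tailSum, Int.cast_sum]
  refine sum_congr rfl fun k hk => inner_e_vec hf (abs_le.2 ?_)
  have := mem_Icc.1 hk
  omega

lemma inner_tailVec_e (hi : 1 ≤ i) (j : ℤ) :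
    inner ℝ (tailVec n i) (e n j) =
      (if i ≤ j ∧ j ≤ n then (1 : ℝ) else 0) - if i ≤ -j ∧ -j ≤ n then 1 else 0 := by
  have : ∀ k ∈ Icc i (n : ℤ), inner ℝ (e n k) (e n j) =
      (if k = j then (1 : ℝ) else 0) - if k = -j then 1 else 0 := fun k hk =>
    inner_e_e ⟨hi.trans (mem_Icc.1 hk).1, (mem_Icc.1 hk).2⟩ j
  rw [tailVec, sum_inner, sum_congr rfl this, sum_sub_distrib, sum_ite_eq', sum_ite_eq']
  simp only [mem_Icc]

lemma inner_tailVec_e_sub_e (hi : 1 ≤ i) {j : ℤ} (hj : j ∈ Set.Icc (1 : ℤ) n) :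
    inner ℝ (tailVec n i) (e n j - e n (j - 1)) = if i = j then 1 else 0 := by
  obtain ⟨hj₁, hjn⟩ := hj
  rw [inner_sub_right, inner_tailVec_e hi, inner_tailVec_e hi, if_neg (c := i ≤ -j ∧ _) (by omega),
    if_neg (c := i ≤ -(j - 1) ∧ _) (by omega)]
  split_ifs <;> first | omega | simp

lemma ext_inner_tailVec {v v' : V n}
    (h : ∀ i ∈ Set.Icc (1 : ℤ) n, inner ℝ (tailVec n i) v = inner ℝ (tailVec n i) v') :
    v = v' := by
  have h' : ∀ i, 1 ≤ i → inner ℝ (tailVec n i) v = inner ℝ (tailVec n i) v' := fun i hi => by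
    by_cases hn : i ≤ n
    · exact h i ⟨hi, hn⟩
    · rw [tailVec, Icc_eq_empty hn, sum_empty, inner_zero_left, inner_zero_left]
  refine ext_inner_e fun a ⟨ha, han⟩ => ?_
  have split : tailVec n a = e n a + tailVec n (a + 1) := by
    rw [tailVec, ← add_sum_Ioc_eq_sum_Icc han, tailVec, ← Order.succ_eq_add_one,
      Finset.Icc_succ_left_eq_Ioc]
  have := h' a ha
  rwa [split, inner_add_left, inner_add_left, h' (a + 1) (by omega), add_left_inj] at this

lemma isNonneg_iff (t : BCType) (x : V n) :
    IsNonneg t n x ↔ ∀ i ∈ Set.Icc (1 : ℤ) n, 0 ≤ inner ℝ (tailVec n i) x := by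
  have coefficient : ∀ (c : ℤ → ℝ), ∀ i ∈ Set.Icc (1 : ℤ) n,
      inner ℝ (tailVec n i) (∑ j ∈ Icc (1 : ℤ) n, c j • simpleRoot t n j) =
        c i * rootScale t i := fun c i hi => by
    have : ∀ j ∈ Icc (1 : ℤ) n, inner ℝ (tailVec n i) (c j • simpleRoot t n j) =
        if i = j then c j * rootScale t j else 0 := fun j hj => by
      rw [simpleRoot_eq, real_inner_smul_right, real_inner_smul_right,
        inner_tailVec_e_sub_e hi.1 (mem_Icc.1 hj), mul_ite, mul_ite, mul_one, mul_zero, mul_zero]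
    rw [inner_sum, sum_congr rfl this, sum_ite_eq, if_pos (mem_Icc.2 hi)]
  constructor
  · rintro ⟨c, hc, rfl⟩ i hi
    rw [coefficient c i hi]
    exact mul_nonneg (hc i (mem_Icc.2 hi)) (rootScale_pos t i).le
  · intro h
    refine ⟨fun j => inner ℝ (tailVec n j) x / rootScale t j, fun j hj => ?_, ?_⟩
    · exact div_nonneg (h j (mem_Icc.1 hj)) (rootScale_pos t j).le
    · refine ext_inner_tailVec fun i hi => ?_
      rw [coefficient _ i hi, div_mul_cancel₀ _ (rootScale_pos t i).ne']

lemma isNonneg_smul_iff (t : BCType) {c : ℝ} (hc : 0 < c) (x : V n) :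
    IsNonneg t n (c • x) ↔ IsNonneg t n x := by
  simp only [isNonneg_iff, real_inner_smul_right, mul_nonneg_iff_of_pos_left hc]

lemma isNonneg_e_sub_e (t : BCType) {a b : ℤ} (ha : |a| ≤ n) (hb : |b| ≤ n) (h : a ≠ b) :
    IsNonneg t n (e n b - e n a) ↔ a < b := by
  rw [abs_le] at ha hb
  have inner_eq : ∀ i, 1 ≤ i → inner ℝ (tailVec n i) (e n b - e n a) =
      (((if i ≤ b ∧ b ≤ n then (1 : ℝ) else 0) - if i ≤ -b ∧ -b ≤ n then 1 else 0) -
        ((if i ≤ a ∧ a ≤ n then (1 : ℝ) else 0) - if i ≤ -a ∧ -a ≤ n then 1 else 0)) :=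
    fun i hi => by rw [inner_sub_right, inner_tailVec_e hi, inner_tailVec_e hi]
  rw [isNonneg_iff]
  constructor
  · intro hnonneg
    by_contra! hba
    rcases lt_or_ge 0 a with ha₀ | ha₀
    · have := hnonneg a ⟨by omega, by omega⟩
      rw [inner_eq a (by omega)] at this
      split_ifs at this <;> first | omega | norm_num at this
    · have := hnonneg (-b) ⟨by omega, by omega⟩
      rw [inner_eq (-b) (by omega)] at this
      split_ifs at this <;> first | omega | norm_num at this
  · rintro hab i ⟨hi, -⟩
    rw [inner_eq i hi]
    split_ifs <;> first | omega | norm_num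

lemma ActsAs.map_simpleRoot (t : BCType) (h : ActsAs n w σ) (j : ℤ) :
    w (simpleRoot t n j) = rootScale t j • (e n (σ j) - e n (σ (j - 1))) := by
  rw [simpleRoot_eq, map_smul, map_sub, h.2, h.2]

lemma ActsAs.map_simpleRoot_mem_roots (t : BCType) (h : ActsAs n w σ) {j : ℤ}
    (hj : j ∈ Set.Icc (1 : ℤ) n) : w (simpleRoot t n j) ∈ roots t n := by
  obtain ⟨hj₁, hjn⟩ := hj
  have upper : |σ j| ≤ n := abs_map_le h.1 (abs_le.2 ⟨by omega, hjn⟩)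
  have lower : 1 ≤ |σ j| := one_le_abs_map h.1 (by omega)
  rw [h.map_simpleRoot t j]
  rcases eq_or_ne j 1 with rfl | hj
  · left
    exact ⟨σ 1, lower, upper, by
      rw [sub_self, map_zero_of_mem h.1, e_zero, sub_zero, rootScale, if_pos rfl]⟩
  · right
    have upper' : |σ (j - 1)| ≤ n := abs_map_le h.1 (abs_le.2 ⟨by omega, by omega⟩)
    have lower' : 1 ≤ |σ (j - 1)| := one_le_abs_map h.1 (by omega)
    refine ⟨σ j, -σ (j - 1), lower, upper, by rwa [abs_neg], by rwa [abs_neg], ?_, ?_⟩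
    · rw [← odd_of_mem h.1, Ne, abs_eq_abs, ← odd_of_mem h.1, σ.injective.eq_iff,
        σ.injective.eq_iff]
      omega
    · rw [rootScale, if_neg hj, one_smul, e_neg, sub_eq_add_neg]

lemma ActsAs.map_simpleRoot_mem_posRoots_iff (t : BCType) (h : ActsAs n w σ) {j : ℤ}
    (hj : j ∈ Set.Icc (1 : ℤ) n) : w (simpleRoot t n j) ∈ posRoots t n ↔ σ (j - 1) < σ j := by
  rw [posRoots, Set.mem_ofPred_eq, and_iff_right (h.map_simpleRoot_mem_roots t hj),
    h.map_simpleRoot, isNonneg_smul_iff t (rootScale_pos t j)]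
  obtain ⟨hj₁, hjn⟩ := hj
  exact isNonneg_e_sub_e t (abs_map_le h.1 (abs_le.2 ⟨by omega, by omega⟩))
    (abs_map_le h.1 (abs_le.2 ⟨by omega, hjn⟩)) (σ.injective.ne (by omega))

lemma ActsAs.mem_minReps_iff (t : BCType) (h : ActsAs n w σ) :
    w ∈ minReps t n {(r : ℤ)} ↔ IsMinRep n r σ := by
  refine and_congr (iff_of_true (h.mem_weylGroup t) h.1) (forall₃_congr fun j hj _ => ?_)
  exact h.map_simpleRoot_mem_posRoots_iff t hj

lemma exists_isMinRep_of_mem_minReps (hw : w ∈ minReps t n {(r : ℤ)}) :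
    ∃ σ, ActsAs n w σ ∧ IsMinRep n r σ :=
  (exists_actsAs hw.1).imp fun _ hσ => ⟨hσ, (hσ.mem_minReps_iff t).1 hw⟩

/-! ### The fundamental weight -/

lemma ext_inner_simpleRoot {v v' : V n} (h : ∀ j ∈ Set.Icc (1 : ℤ) n,
    inner ℝ (simpleRoot t n j) v = inner ℝ (simpleRoot t n j) v') : v = v' := by
  have step : ∀ j ∈ Set.Icc (1 : ℤ) n, inner ℝ (e n (j - 1)) v = inner ℝ (e n (j - 1)) v' →
      inner ℝ (e n j) v = inner ℝ (e n j) v' := fun j hj heq => by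
    have := h j hj
    rwa [simpleRoot_eq, real_inner_smul_left, real_inner_smul_left,
      mul_right_inj' (rootScale_pos t j).ne', inner_sub_left, inner_sub_left, heq,
      sub_left_inj] at this
  refine ext_inner_e fun a ha => ?_
  obtain ⟨ha, han⟩ := ha
  induction a, ha using Int.leInduction with
  | base => exact step 1 ⟨le_rfl, han⟩ (by simp [e_zero])
  | succ a ha ih =>
    refine step (a + 1) ⟨by omega, han⟩ ?_
    rw [add_sub_cancel_right]
    exact ih (by omega)

lemma inner_simpleRoot_fundWeight (t : BCType) (hr : 1 ≤ r) {j : ℤ} (hj : j ∈ Set.Icc (1 : ℤ) n) :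
    inner ℝ (simpleRoot t n j) (vec n (fundWeight n r)) = if j = r then rootScale t j else 0 := by
  have hodd := (fundWeight_isSignVector (n := n) hr).odd
  obtain ⟨hj₁, hjn⟩ := hj
  rw [simpleRoot_eq, real_inner_smul_left, inner_sub_left,
    inner_e_vec hodd (abs_le.2 ⟨by omega, hjn⟩),
    inner_e_vec hodd (abs_le.2 ⟨by omega, by omega⟩)]
  split_ifs with h
  · have : fundWeight n r j = 1 ∧ fundWeight n r (j - 1) = 0 := by
      unfold fundWeight; split_ifs <;> omega
    simp [this]
  · rw [fundWeight_pred hr ⟨hj₁, hjn⟩ h, sub_self, mul_zero]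

lemma inner_simpleRoot_self (t : BCType) (hi : i ∈ Set.Icc (1 : ℤ) n) :
    inner ℝ (simpleRoot t n i) (simpleRoot t n i) =
      rootScale t i ^ 2 * if i = 1 then 1 else 2 := by
  obtain ⟨h₁, hn⟩ := hi
  rw [simpleRoot_eq, real_inner_smul_left, real_inner_smul_right, ← mul_assoc, ← sq]
  congr 1
  rcases eq_or_ne i 1 with rfl | hi
  · rw [sub_self, e_zero, sub_zero, inner_e_e ⟨h₁, hn⟩]
    norm_num
  · rw [inner_sub_left, inner_sub_right, inner_sub_right, inner_e_e ⟨h₁, hn⟩,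
      inner_e_e ⟨h₁, hn⟩, inner_e_e ⟨by omega, by omega⟩, inner_e_e ⟨by omega, by omega⟩]
    split_ifs <;> first | omega | norm_num

lemma IsFundamentalWeight.exists_eq_smul_vec (hω : IsFundamentalWeight t n r ω)
    (hr : r ∈ Set.Icc 1 n) :
    ∃ c : ℝ, 0 < c ∧ (2 ≤ r → c = 1) ∧ ω = c • vec n (fundWeight n r) := by
  have hscale := rootScale_pos t r
  refine ⟨rootScale t r * (if (r : ℤ) = 1 then 1 else 2) / 2, ?_, fun h => ?_,
    ext_inner_simpleRoot (t := t) fun j hj => ?_⟩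
  · split_ifs <;> positivity
  · rw [rootScale, if_neg (by omega), if_neg (by omega)]
    norm_num
  · have hpos : (0 : ℝ) < inner ℝ (simpleRoot t n j) (simpleRoot t n j) := by
      rw [inner_simpleRoot_self t hj]
      have := rootScale_pos t j
      split_ifs <;> positivity
    have hpair := hω j (mem_Icc.2 hj)
    rw [div_eq_iff hpos.ne', real_inner_comm] at hpair
    rw [real_inner_smul_right, inner_simpleRoot_fundWeight t hr.1 hj]
    rcases eq_or_ne j r with rfl | hjr
    · rw [inner_simpleRoot_self t hj, if_pos rfl] at hpair
      rw [if_pos rfl]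
      linarith
    · rw [if_neg hjr] at hpair ⊢
      linarith

lemma ActsAs.map_fundamentalWeight (h : ActsAs n w σ) (hω : IsFundamentalWeight t n r ω)
    (hr : r ∈ Set.Icc 2 n) : w ω = vec n (weight n r σ) := by
  have hr₁ : 1 ≤ r := one_le_two.trans hr.1
  obtain ⟨c, -, hc, rfl⟩ := hω.exists_eq_smul_vec ⟨hr₁, hr.2⟩
  rw [hc hr.1, one_smul, h.map_vec (fundWeight_isSignVector hr₁).odd, weight]

lemma ActsAs.isNonpos_iff (h : ActsAs n w σ) (hω : IsFundamentalWeight t n r ω)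
    (hr : r ∈ Set.Icc 1 n) : IsNonpos t n (w ω) ↔ IsTailNonpos n (weight n r σ) := by
  obtain ⟨c, hc, -, rfl⟩ := hω.exists_eq_smul_vec hr
  rw [map_smul, h.map_vec (fundWeight_isSignVector hr.1).odd, IsNonpos, ← smul_neg,
    isNonneg_smul_iff t hc, isNonneg_iff, ← weight]
  refine forall₂_congr fun i hi => ?_
  rw [inner_neg_right, inner_tailVec_vec (weight_isSignVector hr.1 h.1).odd hi.1]
  exact_mod_cast neg_nonneg

/-! ### The minimal elements -/

lemma BruhatLE.eq_or_length_lt {u : V n ≃ₗᵢ[ℝ] V n} (h : BruhatLE t n u w) :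
    u = w ∨ length t n u < length t n w := by
  induction h with
  | refl => exact .inl rfl
  | tail _ hstep ih =>
    obtain ⟨β, -, -, hlt⟩ := hstep
    rcases ih with rfl | ih
    · exact .inr hlt
    · exact .inr (ih.trans hlt)

/-- `w` is the element of `W^{I_r}` that maps `e r + ⋯ + e n`, a multiple of the fundamental
weight `ω_r`, to the vector with coordinates `f`. -/
def HasWeight (n r : ℕ) (f : ℤ → ℤ) (w : V n ≃ₗᵢ[ℝ] V n) : Prop :=
  ∃ σ, ActsAs n w σ ∧ IsMinRep n r σ ∧ weight n r σ = f

/-- `w ∈ W^{I_r}` maps `e r + ⋯ + e n` to `-∑ i ∈ l, (e i - e (i - 1))`, where `l` is a list of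
non-adjacent indices. -/
def IsBlockElement (n r : ℕ) (l : List ℤ) (w : V n ≃ₗᵢ[ℝ] V n) : Prop :=
  IsSparse n l ∧ HasWeight n r (-blockSum l) w

lemma exists_isBlockElement_bruhatLE (h : ActsAs n w σ) (hσ : IsMinRep n r σ) (hr : 1 ≤ r)
    (hneg : IsTailNonpos n (weight n r σ)) :
    ∃ u l, IsBlockElement n r l u ∧ BruhatLE t n u w := by
  induction hk : inversions n σ using Nat.strong_induction_on generalizing w σ with
  | _ k ih =>
    rcases hσ.eq_neg_blockSum_or_exists_lower hr hneg with
      ⟨l, hl, hw⟩ | ⟨i, hi, hmin, hneg', hinv⟩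
    · exact ⟨w, l, ⟨hl, σ, h, hσ, hw⟩, Relation.ReflTransGen.refl⟩
    · have hlower : ActsAs n (s t n i * w) (simplePerm i * σ) := (actsAs_s t hi).mul h
      obtain ⟨u, l, hu, hle⟩ := ih _ (by omega) hlower hmin hneg' rfl
      refine ⟨u, l, hu, hle.tail ⟨simpleRoot t n i, ?_, ?_, ?_⟩⟩
      · exact (ActsAs.one n).map_simpleRoot_mem_roots t hi
      · exact (mul_inv_cancel_left (s t n i) w).symm.trans
          (congrArg (· * (s t n i * w)) Submodule.reflection_inv)
      · rw [hlower.length_eq t, h.length_eq t]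
        omega

/-- The sequences `l` of non-adjacent indices for which `∑ i ∈ l, (e i - e (i - 1))` lies in the
Weyl group orbit of `e r + ⋯ + e n`. -/
def IsAdmissible (n r : ℕ) (l : List ℤ) : Prop :=
  IsSparse n l ∧ numNonzero n (blockSum l) = n + 1 - r

lemma isAdmissible_iff : IsAdmissible n r l ↔
    IsSparse n l ∧ n + 1 - r + (if (1 : ℤ) ∈ l then 1 else 0) = 2 * l.length :=
  and_congr_right fun hl => by
    have := hl.numNonzero_blockSum
    omega

lemma IsBlockElement.isAdmissible (h : IsBlockElement n r l w) (hr : 1 ≤ r) :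
    IsAdmissible n r l := by
  obtain ⟨hl, σ, -, hσ, hw⟩ := h
  exact ⟨hl, by rw [← numNonzero_neg, ← hw, numNonzero_weight hr hσ.1]⟩

lemma IsBlockElement.length_eq (t : BCType) (h : IsBlockElement n r l w)
    (h' : IsBlockElement n r l' w') (hr : 1 ≤ r) : length t n w = length t n w' := by
  obtain ⟨hl, card⟩ := isAdmissible_iff.1 (h.isAdmissible hr)
  obtain ⟨hl', card'⟩ := isAdmissible_iff.1 (h'.isAdmissible hr)
  obtain ⟨-, σ, hw, hσ, hweight⟩ := h
  obtain ⟨-, σ', hw', hσ', hweight'⟩ := h'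
  have inv := hσ.two_mul_inversions hr hl hweight
  have inv' := hσ'.two_mul_inversions hr hl' hweight'
  rw [hw.length_eq t, hw'.length_eq t]
  split_ifs at card card' <;> omega

lemma mem_minimalNonpos_iff (hω : IsFundamentalWeight t n r ω) (hr : r ∈ Set.Icc 1 n) :
    w ∈ minimalNonpos t n {(r : ℤ)} ω ↔ ∃ l, IsBlockElement n r l w := by
  have exists_le : ∀ u ∈ minReps t n {(r : ℤ)}, IsNonpos t n (u ω) →
      ∃ u' l, IsBlockElement n r l u' ∧ BruhatLE t n u' u := fun u hu hneg => by
    obtain ⟨σ, hσ, hmin⟩ := exists_isMinRep_of_mem_minReps hu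
    exact exists_isBlockElement_bruhatLE hσ hmin hr.1 ((hσ.isNonpos_iff hω hr).1 hneg)
  have mem_of_isBlockElement : ∀ {u l}, IsBlockElement n r l u →
      u ∈ minReps t n {(r : ℤ)} ∧ IsNonpos t n (u ω) := by
    rintro u l ⟨hl, σ, hu, hσ, hweight⟩
    refine ⟨(hu.mem_minReps_iff t).2 hσ, (hu.isNonpos_iff hω hr).2 fun i hi => ?_⟩
    rw [hweight, tailSum_neg, hl.tailSum_blockSum hi.1]
    split_ifs <;> omega
  constructor
  · rintro ⟨⟨hmem, hneg⟩, hmin⟩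
    obtain ⟨u, l, hu, hle⟩ := exists_le w hmem hneg
    have hu' := mem_of_isBlockElement hu
    exact ⟨l, hmin u hu'.1 hu'.2 hle ▸ hu⟩
  · rintro ⟨l, hl⟩
    refine ⟨mem_of_isBlockElement hl, fun u hu hneg hle => ?_⟩
    obtain ⟨u', l', hu', hle'⟩ := exists_le u hu hneg
    have heq := hu'.length_eq t hl hr.1
    rcases hle.eq_or_length_lt with h | h <;> rcases hle'.eq_or_length_lt with h' | h' <;>
      first | exact h | (subst h'; omega) | omega

end SignedPermutations

section MinimalElements

variable {t : BCType} {n r m : ℕ} {p : ℤ} {i l : List ℤ} {f g : ℤ → ℤ} {ω : V n}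
  {v w : V n ≃ₗᵢ[ℝ] V n} {σ : Equiv.Perm ℤ}

/-! ### Elements of `W^{I_r}` with a given weight -/

lemma vec_injOn : Set.InjOn (vec n) {f | IsSignVector n f} := by
  refine fun f hf g hg h => odd_ext hf.odd hg.odd fun a _ => ?_
  rcases lt_or_ge (n : ℤ) |a| with han | han
  · rw [hf.eq_zero a han, hg.eq_zero a han]
  · have := congrArg (inner ℝ (e n a)) h
    rw [inner_e_vec hf.odd han, inner_e_vec hg.odd han] at this
    exact_mod_cast this

lemma HasWeight.unique (h : HasWeight n r f v) (h' : HasWeight n r f w) (hr : 1 ≤ r) : v = w := by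
  obtain ⟨σ, hv, hσ, hf⟩ := h
  obtain ⟨τ, hw, hτ, hf'⟩ := h'
  obtain rfl := hσ.eq_of_weight_eq hτ hr (hf.trans hf'.symm)
  exact hv.left_unique hw

lemma HasWeight.mem_minReps (t : BCType) (h : HasWeight n r f v) :
    v ∈ minReps t n {(r : ℤ)} := by
  obtain ⟨σ, hv, hσ, -⟩ := h
  exact (hv.mem_minReps_iff t).2 hσ

lemma HasWeight.map_fundamentalWeight (h : HasWeight n r f v) (hω : IsFundamentalWeight t n r ω)
    (hr : r ∈ Set.Icc 2 n) : v ω = vec n f := by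
  obtain ⟨σ, hv, -, rfl⟩ := h
  exact hv.map_fundamentalWeight hω hr

lemma hasWeight_of_map_fundamentalWeight (hω : IsFundamentalWeight t n r ω)
    (hr : r ∈ Set.Icc 2 n) (hf : IsSignVector n f) (hv : v ∈ minReps t n {(r : ℤ)})
    (h : v ω = vec n f) : HasWeight n r f v := by
  obtain ⟨σ, hvσ, hσ⟩ := exists_isMinRep_of_mem_minReps hv
  refine ⟨σ, hvσ, hσ, vec_injOn (weight_isSignVector (one_le_two.trans hr.1) hσ.1) hf ?_⟩
  rw [← h, hvσ.map_fundamentalWeight hω hr]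

lemma HasWeight.wordProd_mul (t : BCType) (h : HasWeight n r (blockSum l) v)
    (hl : IsSparse n l) (hr : 1 ≤ r) : HasWeight n r (-blockSum l) (wordProd t n l * v) := by
  obtain ⟨σ, hv, hσ, hw⟩ := h
  exact ⟨_, (actsAs_wordProd t hl.mem).mul hv, hσ.wordPerm_mul hr hl hw,
    hσ.weight_wordPerm_mul hr hl hw⟩

lemma ActsAs.hasOneLine (h : ActsAs n w σ) (hl : List.ofFn (fun j : Fin n => σ (j + 1)) = l) :
    HasOneLine n w l := by
  subst hl
  constructor
  · intro x hx
    obtain ⟨j, rfl⟩ := List.mem_ofFn.1 hx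
    exact ⟨one_le_abs_map h.1 (by omega), abs_map_le h.1 (abs_le.2 ⟨by omega, by omega⟩)⟩
  · rw [List.map_ofFn]
    exact congrArg List.ofFn (funext fun j => h.2 _)

lemma HasWeight.hasOneLine (h : HasWeight n r f w) (hr : 1 ≤ r) {A B : List ℤ}
    (hA : A.Pairwise (· < ·)) (hB : B.Pairwise (· < ·))
    (memA : ∀ p, p ∈ A ↔ (1 ≤ p ∧ p ≤ n) ∧ f p = 0) (memB : ∀ p, p ∈ B ↔ f p = 1) :
    HasOneLine n w (A ++ B) := by
  obtain ⟨σ, hw, hσ, rfl⟩ := h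
  exact hw.hasOneLine (hσ.ofFn_eq_append hr hA hB memA memB)

/-! ### Sequences of non-adjacent indices -/

lemma mem_complUp {S : Finset ℤ} : p ∈ complUp n S ↔ (1 ≤ p ∧ p ≤ n) ∧ p ∉ S := by
  simp [complUp]

lemma pairwise_complUp (n : ℕ) (S : Finset ℤ) : (complUp n S).Pairwise (· < ·) :=
  (sortedLT_sort _).pairwise

lemma mem_negSeq : p ∈ negSeq l ↔ -p ∈ l := by
  simp [negSeq, neg_eq_iff_eq_neg]

lemma pairwise_negSeq (hl : l.Pairwise (· < ·)) : (negSeq l).Pairwise (· < ·) :=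
  List.pairwise_reverse.2 (hl.map _ fun _ _ => neg_lt_neg)

lemma mem_predSeq : p ∈ predSeq l ↔ p + 1 ∈ l := by
  simp [predSeq, sub_eq_iff_eq_add]

lemma pairwise_predSeq (hl : l.Pairwise (· < ·)) : (predSeq l).Pairwise (· < ·) :=
  hl.map _ fun _ _ h => sub_lt_sub_right h 1

lemma mem_J_iff {a b : ℤ} : l ∈ J m a b ↔
    l.length = m ∧ (∀ x ∈ l, a ≤ x ∧ x ≤ b) ∧ l.Pairwise fun x y => x + 2 ≤ y := by
  have : Trans (fun x y : ℤ => x + 2 ≤ y) (fun x y => x + 2 ≤ y) (fun x y => x + 2 ≤ y) :=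
    ⟨fun hxy hyz => by omega⟩
  have gap : (fun x y : ℤ => 2 ≤ y - x) = fun x y => x + 2 ≤ y :=
    funext₂ fun x y => propext ⟨fun _ => by omega, fun _ => by omega⟩
  rw [J, Set.mem_ofPred_eq, gap, List.isChain_iff_pairwise]

lemma isAdmissible_iff_mem_J_two (hm : n + 1 = r + 2 * m) :
    IsAdmissible n r l ↔ l ∈ J m 2 n := by
  rw [isAdmissible_iff, mem_J_iff]
  constructor
  · rintro ⟨hl, hcard⟩
    have h₁ : (1 : ℤ) ∉ l := fun h => by
      rw [if_pos h] at hcard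
      omega
    rw [if_neg h₁] at hcard
    refine ⟨by omega, fun x hx => ⟨?_, (hl.mem x hx).2⟩, hl.pairwise⟩
    have : x ≠ 1 := fun h => h₁ (h ▸ hx)
    have := (hl.mem x hx).1
    omega
  · rintro ⟨hlen, hmem, hpair⟩
    have h₁ : (1 : ℤ) ∉ l := fun h => by have := (hmem 1 h).1; omega
    refine ⟨⟨fun x hx => ⟨by linarith [(hmem x hx).1], (hmem x hx).2⟩, hpair⟩, ?_⟩
    rw [if_neg h₁]
    omega

lemma isAdmissible_iff_mem_J_three (hr : r ∈ Set.Icc 1 n) (hm : n + 1 = r + (2 * m + 1)) :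
    IsAdmissible n r l ↔ ∃ i ∈ J m 3 n, 1 :: i = l := by
  rw [isAdmissible_iff]
  constructor
  · rintro ⟨hl, hcard⟩
    have h₁ : (1 : ℤ) ∈ l := by
      by_contra h
      rw [if_neg h] at hcard
      omega
    rw [if_pos h₁] at hcard
    rcases l with - | ⟨a, i⟩
    · simp at h₁
    obtain ⟨hgap, hpair⟩ := List.pairwise_cons.1 hl.pairwise
    have ha := (hl.mem a (List.mem_cons_self)).1
    obtain rfl : 1 = a := by
      rcases List.mem_cons.1 h₁ with h | h
      · exact h
      · have := hgap 1 h
        omega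
    refine ⟨i, mem_J_iff.2 ⟨by simp at hcard; omega, fun x hx => ?_, hpair⟩, rfl⟩
    exact ⟨hgap x hx, (hl.mem x (List.mem_cons_of_mem _ hx)).2⟩
  · rintro ⟨i, hi, rfl⟩
    obtain ⟨hlen, hmem, hpair⟩ := mem_J_iff.1 hi
    have hn : (1 : ℤ) ≤ n := by exact_mod_cast hr.1.trans hr.2
    have hmem' : ∀ x ∈ i, x ∈ Set.Icc (1 : ℤ) n := fun x hx =>
      ⟨by linarith [(hmem x hx).1], (hmem x hx).2⟩
    refine ⟨⟨List.forall_mem_cons.2 ⟨⟨le_rfl, hn⟩, hmem'⟩,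
      List.pairwise_cons.2 ⟨fun x hx => (hmem x hx).1, hpair⟩⟩, ?_⟩
    rw [if_pos List.mem_cons_self, List.length_cons]
    omega

lemma vec_blockSum (hl : IsSparse n l) :
    vec n (blockSum l) = (l.map fun i => e n i - e n (i - 1)).sum := by
  refine ext_inner_tailVec fun j hj => ?_
  have inner_sum : ∀ l : List ℤ, l.Nodup → (∀ i ∈ l, i ∈ Set.Icc (1 : ℤ) n) →
      inner ℝ (tailVec n j) (l.map fun i => e n i - e n (i - 1)).sum =
        if j ∈ l then (1 : ℝ) else 0 := fun l hnodup hmem => by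
    induction l with
    | nil => simp
    | cons i l ih =>
      obtain ⟨hil, hnodup⟩ := List.nodup_cons.1 hnodup
      obtain ⟨hi, hmem⟩ := List.forall_mem_cons.1 hmem
      rw [List.map_cons, List.sum_cons, inner_add_right, inner_tailVec_e_sub_e hj.1 hi,
        ih hnodup hmem]
      by_cases h : j = i
      · simp [h, hil]
      · simp [h]
  rw [inner_tailVec_vec (blockSum_odd l) hj.1, hl.tailSum_blockSum hj.1,
    inner_sum l hl.nodup hl.mem]
  push_cast
  rfl

lemma smul_simpleRoot_one (t : BCType) (n : ℕ) :
    (1 / t.specialLength) • simpleRoot t n 1 = e n 1 - e n (1 - 1) := by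
  rw [simpleRoot, if_pos rfl, smul_smul, one_div, inv_mul_cancel₀ (specialLength_pos t).ne',
    one_smul, sub_self, e_zero, sub_zero]

lemma map_simpleRoot_eq (t : BCType) (n : ℕ) (hi : ∀ x ∈ i, x ≠ 1) :
    i.map (simpleRoot t n) = i.map fun x => e n x - e n (x - 1) :=
  List.map_congr_left fun x hx => if_neg (hi x hx)

/-! ### One-line notation of the blocks -/

lemma mem_complUp_block (hl : IsSparse n l) :
    p ∈ complUp n (l.toFinset ∪ (predSeq (l.erase 1)).toFinset) ↔
      (1 ≤ p ∧ p ≤ n) ∧ blockSum l p = 0 := by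
  rw [mem_complUp]
  refine and_congr_right fun hp => ?_
  rw [mem_union, List.mem_toFinset, List.mem_toFinset, mem_predSeq, hl.mem_erase_one,
    ← not_ne_iff (a := blockSum l p), hl.blockSum_ne_zero_iff hp.1,
    and_iff_right (show 2 ≤ p + 1 by omega)]

lemma HasWeight.hasOneLine_blockSum (h : HasWeight n r (blockSum l) v) (hl : IsSparse n l)
    (hr : 1 ≤ r) :
    HasOneLine n v (complUp n (l.toFinset ∪ (predSeq (l.erase 1)).toFinset) ++
      (negSeq (predSeq (l.erase 1)) ++ l)) := by
  refine h.hasOneLine hr (pairwise_complUp ..) (List.pairwise_append.2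
    ⟨pairwise_negSeq (pairwise_predSeq (hl.lt.sublist List.erase_sublist)), hl.lt, ?_⟩)
    (fun p => mem_complUp_block hl) fun p => ?_
  · intro p hp q hq
    rw [mem_negSeq, mem_predSeq, hl.mem_erase_one] at hp
    have := (hl.mem q hq).1
    omega
  · rw [hl.blockSum_eq_one_iff, List.mem_append, mem_negSeq, mem_predSeq, neg_add_eq_sub, or_comm]

lemma HasWeight.hasOneLine_neg_blockSum (h : HasWeight n r (-blockSum l) w) (hl : IsSparse n l)
    (hr : 1 ≤ r) :
    HasOneLine n w (complUp n (l.toFinset ∪ (predSeq (l.erase 1)).toFinset) ++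
      (negSeq l ++ predSeq (l.erase 1))) := by
  refine h.hasOneLine hr (pairwise_complUp ..) (List.pairwise_append.2
    ⟨pairwise_negSeq hl.lt, pairwise_predSeq (hl.lt.sublist List.erase_sublist), ?_⟩)
    (fun p => ?_) fun p => ?_
  · intro p hp q hq
    rw [mem_negSeq] at hp
    rw [mem_predSeq, hl.mem_erase_one] at hq
    have := (hl.mem _ hp).1
    omega
  · rw [mem_complUp_block hl, Pi.neg_apply, neg_eq_zero]
  · rw [Pi.neg_apply, ← blockSum_odd, hl.blockSum_eq_one_iff, sub_neg_eq_add, add_comm,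
      List.mem_append, mem_negSeq, mem_predSeq]

/-! ### The sets of minimal elements -/

lemma exists_hasWeight (t : BCType) (hr : 1 ≤ r) (hl : IsAdmissible n r l) :
    ∃ v, HasWeight n r (blockSum l) v := by
  obtain ⟨σ, hσ, hw⟩ := exists_isMinRep hr hl.1.blockSum_isSignVector hl.2
  obtain ⟨v, -, hv⟩ := exists_actsAs_of_mem_signedPerms t hσ.1
  exact ⟨v, σ, hv, hσ, hw⟩

lemma exists_minimalNonpos_eq_image {ι : Type*} {S : Set ι} {word : ι → List ℤ}
    (hω : IsFundamentalWeight t n r ω) (hr : r ∈ Set.Icc 1 n)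
    (hS : ∀ l, IsAdmissible n r l ↔ ∃ i ∈ S, word i = l) :
    ∃ v : ι → V n ≃ₗᵢ[ℝ] V n,
      (∀ i ∈ S, IsSparse n (word i) ∧ HasWeight n r (blockSum (word i)) (v i)) ∧
      minimalNonpos t n {(r : ℤ)} ω = (fun i => wordProd t n (word i) * v i) '' S := by
  have hadm : ∀ i ∈ S, IsAdmissible n r (word i) := fun i hi => (hS _).2 ⟨i, hi, rfl⟩
  choose! v hv using fun i hi => exists_hasWeight t hr.1 (hadm i hi)
  have hw : ∀ i ∈ S, HasWeight n r (-blockSum (word i)) (wordProd t n (word i) * v i) :=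
    fun i hi => (hv i hi).wordProd_mul t (hadm i hi).1 hr.1
  refine ⟨v, fun i hi => ⟨(hadm i hi).1, hv i hi⟩, Set.ext fun w => ?_⟩
  rw [mem_minimalNonpos_iff hω hr]
  constructor
  · rintro ⟨l, hl⟩
    obtain ⟨i, hi, rfl⟩ := (hS l).1 (hl.isAdmissible hr.1)
    exact ⟨i, hi, (hw i hi).unique hl.2 hr.1⟩
  · rintro ⟨i, hi, rfl⟩
    exact ⟨word i, (hadm i hi).1, hw i hi⟩

lemma exists_minimalNonpos_eq_singleton (hω : IsFundamentalWeight t n r ω) (hr : r ∈ Set.Icc 1 n)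
    (hl : ∀ l', IsAdmissible n r l' ↔ l' = l) :
    ∃ w, HasOneLine n w (complUp n (l.toFinset ∪ (predSeq (l.erase 1)).toFinset) ++
      (negSeq l ++ predSeq (l.erase 1))) ∧ minimalNonpos t n {(r : ℤ)} ω = {w} := by
  obtain ⟨v, hv, hmin⟩ := exists_minimalNonpos_eq_image (S := {l}) (word := id) hω hr
    fun l' => by simp [hl, eq_comm]
  obtain ⟨hl, hv⟩ := hv l rfl
  exact ⟨_, (hv.wordProd_mul t hl hr.1).hasOneLine_neg_blockSum hl hr.1,
    hmin.trans Set.image_singleton⟩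

/-- The sequence `(…, n - 4, n - 2, n)` of the positive integers up to `n` of the parity of `n`. -/
def alternatingSeq (n : ℕ) : List ℤ :=
  ((List.range ((n + 1) / 2)).map fun j : ℕ => (n : ℤ) - 2 * j).reverse

lemma mem_alternatingSeq : p ∈ alternatingSeq n ↔ (1 ≤ p ∧ p ≤ n) ∧ (n - p) % 2 = 0 := by
  simp only [alternatingSeq, List.mem_reverse, List.mem_map, List.mem_range]
  constructor
  · rintro ⟨j, hj, rfl⟩
    omega
  · exact fun h => ⟨((n - p) / 2).toNat, by omega, by omega⟩

lemma isSparse_alternatingSeq (n : ℕ) : IsSparse n (alternatingSeq n) where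
  mem p hp := (mem_alternatingSeq.1 hp).1
  pairwise := List.pairwise_reverse.2 <|
    List.pairwise_lt_range.map _ fun a b hab => by omega

lemma isAdmissible_one_iff : IsAdmissible n 1 l ↔ l = alternatingSeq n := by
  constructor
  · rintro ⟨hl, hcard⟩
    have support : (Icc (1 : ℤ) n).filter (fun a => blockSum l a ≠ 0) = Icc (1 : ℤ) n :=
      eq_of_subset_of_card_le (filter_subset ..) (by
        rw [← numNonzero, hcard, Int.card_Icc]
        omega)
    have cover : ∀ p : ℤ, 1 ≤ p → p ≤ n → (p ∈ l ∨ p + 1 ∈ l) := fun p hp hpn =>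
      (hl.blockSum_ne_zero_iff hp).1 (filter_eq_self.1 support p (mem_Icc.2 ⟨hp, hpn⟩))
    have mem_iff : ∀ p : ℤ, 1 ≤ p → p ≤ n → (p ∈ l ↔ (n - p) % 2 = 0) := fun p hp hpn => by
      induction p, hpn using Int.leInductionDown with
      | base =>
        have : (n : ℤ) + 1 ∉ l := fun h => by have := (hl.mem _ h).2; omega
        simpa [this] using cover n hp le_rfl
      | pred p hpn ih =>
        have := ih (by omega)
        have hsucc := hl.succ_notMem (x := p - 1)
        have hcover := cover (p - 1) hp (by omega)
        rw [sub_add_cancel] at hsucc hcover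
        grind
    refine List.Pairwise.eq_of_mem_iff hl.lt (isSparse_alternatingSeq n).lt fun p => ?_
    rw [mem_alternatingSeq]
    exact ⟨fun hp => ⟨hl.mem p hp, (mem_iff p (hl.mem p hp).1 (hl.mem p hp).2).1 hp⟩,
      fun hp => (mem_iff p hp.1.1 hp.1.2).2 hp.2⟩
  · rintro rfl
    refine isAdmissible_iff.2 ⟨isSparse_alternatingSeq n, ?_⟩
    simp only [mem_alternatingSeq]
    simp only [alternatingSeq, List.length_reverse, List.length_map, List.length_range]
    split_ifs <;> omega

lemma isAdmissible_self_iff (hn : 1 ≤ n) : IsAdmissible n n l ↔ l = [1] := by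
  rw [isAdmissible_iff_mem_J_three ⟨hn, le_rfl⟩ (m := 0) (by omega)]
  simp [mem_J_iff, eq_comm]

lemma complUp_alternatingSeq (n : ℕ) : complUp n ((alternatingSeq n).toFinset ∪
    (predSeq ((alternatingSeq n).erase 1)).toFinset) = [] := by
  refine List.eq_nil_iff_forall_not_mem.2 fun p hp => ?_
  obtain ⟨hp, hzero⟩ := (mem_complUp_block (isSparse_alternatingSeq n)).1 hp
  refine ((isSparse_alternatingSeq n).blockSum_ne_zero_iff hp.1).2 ?_ hzero
  simp only [mem_alternatingSeq]
  omega

lemma negSeq_alternatingSeq (n : ℕ) : negSeq (alternatingSeq n) =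
    (List.range ((n + 1) / 2)).map fun j : ℕ => -((n : ℤ) - 2 * j) := by
  rw [negSeq, alternatingSeq, List.map_reverse, List.reverse_reverse, List.map_map]
  rfl

lemma predSeq_erase_alternatingSeq (n : ℕ) : predSeq ((alternatingSeq n).erase 1) =
    (List.range (n / 2)).map fun j : ℕ => 2 * (j : ℤ) + (n % 2 + 1) := by
  have hl := isSparse_alternatingSeq n
  refine List.Pairwise.eq_of_mem_iff (pairwise_predSeq (hl.lt.sublist List.erase_sublist))
    (List.pairwise_lt_range.map _ fun a b hab => by omega) fun p => ?_
  simp only [mem_predSeq, hl.mem_erase_one, mem_alternatingSeq, List.mem_map, List.mem_range]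
  constructor
  · exact fun h => ⟨((p - 1) / 2).toNat, by omega, by omega⟩
  · rintro ⟨j, hj, rfl⟩
    omega

lemma exists_minimalNonpos_one (hω : IsFundamentalWeight t n 1 ω) (hn : 1 ≤ n) :
    ∃ w, HasOneLine n w ((List.range ((n + 1) / 2)).map (fun j : ℕ => -((n : ℤ) - 2 * j)) ++
      (List.range (n / 2)).map fun j : ℕ => 2 * (j : ℤ) + (n % 2 + 1)) ∧
      minimalNonpos t n {1} ω = {w} := by
  have := exists_minimalNonpos_eq_singleton (r := 1) (by exact_mod_cast hω) ⟨le_rfl, hn⟩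
    fun _ => isAdmissible_one_iff
  rwa [complUp_alternatingSeq, negSeq_alternatingSeq, predSeq_erase_alternatingSeq,
    List.nil_append, Nat.cast_one] at this

lemma complUp_one (n : ℕ) :
    complUp n {1} = (List.range (n - 1)).map fun j : ℕ => (j : ℤ) + 2 := by
  refine List.Pairwise.eq_of_mem_iff (pairwise_complUp ..)
    (List.pairwise_lt_range.map _ fun a b hab => by omega) fun p => ?_
  simp only [mem_complUp, mem_singleton, List.mem_map, List.mem_range]
  constructor
  · exact fun h => ⟨(p - 2).toNat, by omega, by omega⟩
  · rintro ⟨j, hj, rfl⟩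
    omega

lemma exists_minimalNonpos_self (hω : IsFundamentalWeight t n n ω) (hn : 1 ≤ n) :
    ∃ w, HasOneLine n w ((List.range (n - 1)).map (fun j : ℕ => (j : ℤ) + 2) ++ [-1]) ∧
      minimalNonpos t n {(n : ℤ)} ω = {w} := by
  rw [← complUp_one]
  exact exists_minimalNonpos_eq_singleton hω ⟨hn, le_rfl⟩ fun _ => isAdmissible_self_iff hn

lemma HasWeight.blockSum_spec (h : HasWeight n r (blockSum l) v) (hl : IsSparse n l)
    (hω : IsFundamentalWeight t n r ω) (hr : r ∈ Set.Icc 2 n) :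
    (v ∈ minReps t n {(r : ℤ)} ∧ v ω = vec n (blockSum l) ∧
      ∀ u ∈ minReps t n {(r : ℤ)}, u ω = vec n (blockSum l) → u = v) ∧
    HasOneLine n v (complUp n (l.toFinset ∪ (predSeq (l.erase 1)).toFinset) ++
      (negSeq (predSeq (l.erase 1)) ++ l)) ∧
    HasOneLine n (wordProd t n l * v) (complUp n (l.toFinset ∪ (predSeq (l.erase 1)).toFinset) ++
      (negSeq l ++ predSeq (l.erase 1))) ∧
    (wordProd t n l * v) ω = -(v ω) := by
  have hr₁ : 1 ≤ r := one_le_two.trans hr.1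
  have hw := h.wordProd_mul t hl hr₁
  refine ⟨⟨h.mem_minReps t, h.map_fundamentalWeight hω hr, fun u hu huω => ?_⟩,
    h.hasOneLine_blockSum hl hr₁, hw.hasOneLine_neg_blockSum hl hr₁, ?_⟩
  · exact (hasWeight_of_map_fundamentalWeight hω hr hl.blockSum_isSignVector hu huω).unique h hr₁
  · rw [hw.map_fundamentalWeight hω hr, h.map_fundamentalWeight hω hr, vec_neg]

lemma wordProd_cons (t : BCType) (n : ℕ) (a : ℤ) (l : List ℤ) :
    wordProd t n (a :: l) = s t n a * wordProd t n l := by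
  rw [wordProd, List.map_cons, List.prod_cons, wordProd]

lemma negSeq_cons (a : ℤ) (l : List ℤ) : negSeq (a :: l) = negSeq l ++ [-a] := by
  rw [negSeq, List.map_cons, List.reverse_cons, negSeq]

lemma erase_one_of_mem_J_two (hi : i ∈ J m 2 n) : i.erase 1 = i :=
  List.erase_of_not_mem fun h => absurd (hi.2.1 1 h).1 (by norm_num)

lemma vec_blockSum_of_mem_J_two (t : BCType) (hl : IsSparse n i) (hi : i ∈ J m 2 n) :
    vec n (blockSum i) = (i.map (simpleRoot t n)).sum := by
  rw [vec_blockSum hl, map_simpleRoot_eq]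
  rintro x hx rfl
  exact absurd (hi.2.1 1 hx).1 (by norm_num)

lemma vec_blockSum_one_cons (t : BCType) (hl : IsSparse n (1 :: i)) :
    vec n (blockSum (1 :: i)) =
      (1 / t.specialLength) • simpleRoot t n 1 + (i.map (simpleRoot t n)).sum := by
  rw [vec_blockSum hl, List.map_cons, List.sum_cons, smul_simpleRoot_one, map_simpleRoot_eq]
  rintro x hx rfl
  exact (List.nodup_cons.1 hl.nodup).1 hx

end MinimalElements

end

end BCType

theorem proposition4p3 (t : BCType) (n r : ℕ) (hr : 1 ≤ r) (hrn : r ≤ n)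
    (ω : BCType.V n) (hω : BCType.IsFundamentalWeight t n r ω) :
    -- (i), `n` even
    (∀ k : ℕ, r = 1 → n = 2 * k →
      ∃ w, BCType.HasOneLine n w
          ((List.range k).map (fun j : ℕ => -((n : ℤ) - 2 * j)) ++
            (List.range k).map (fun j : ℕ => 2 * (j : ℤ) + 1)) ∧
        BCType.minimalNonpos t n {(r : ℤ)} ω = {w}) ∧
    -- (i), `n` odd
    (∀ k : ℕ, r = 1 → n = 2 * k + 1 →
      ∃ w, BCType.HasOneLine n w
          ((List.range (k + 1)).map (fun j : ℕ => -((n : ℤ) - 2 * j)) ++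
            (List.range k).map (fun j : ℕ => 2 * (j : ℤ) + 2)) ∧
        BCType.minimalNonpos t n {(r : ℤ)} ω = {w}) ∧
    -- (ii)
    (∀ m : ℕ, 2 ≤ r → r + 1 ≤ n → n + 1 = r + 2 * m →
      ∃ v : List ℤ → (BCType.V n ≃ₗᵢ[ℝ] BCType.V n),
        (∀ i ∈ BCType.J m 2 n,
          (v i ∈ BCType.minReps t n {(r : ℤ)} ∧
            v i ω = (i.map (BCType.simpleRoot t n)).sum ∧
            ∀ u ∈ BCType.minReps t n {(r : ℤ)},
              u ω = (i.map (BCType.simpleRoot t n)).sum → u = v i) ∧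
          BCType.HasOneLine n (v i)
            (BCType.complUp n (i.toFinset ∪ (BCType.predSeq i).toFinset) ++
              BCType.negSeq (BCType.predSeq i) ++ i) ∧
          BCType.HasOneLine n (BCType.wordProd t n i * v i)
            (BCType.complUp n (i.toFinset ∪ (BCType.predSeq i).toFinset) ++
              BCType.negSeq i ++ BCType.predSeq i) ∧
          (BCType.wordProd t n i * v i) ω = -(v i ω)) ∧
        BCType.minimalNonpos t n {(r : ℤ)} ω =
          (fun i => BCType.wordProd t n i * v i) '' BCType.J m 2 n) ∧
    -- (iii); the coefficient of `α_1` is `1` in type `B_n` and `1/2` in type `C_n`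
    (∀ m : ℕ, 2 ≤ r → r + 1 ≤ n → n + 1 = r + (2 * m + 1) →
      ∃ v : List ℤ → (BCType.V n ≃ₗᵢ[ℝ] BCType.V n),
        (∀ i ∈ BCType.J m 3 n,
          (v i ∈ BCType.minReps t n {(r : ℤ)} ∧
            v i ω = (1 / t.specialLength) • BCType.simpleRoot t n 1 +
              (i.map (BCType.simpleRoot t n)).sum ∧
            ∀ u ∈ BCType.minReps t n {(r : ℤ)},
              u ω = (1 / t.specialLength) • BCType.simpleRoot t n 1 +
                (i.map (BCType.simpleRoot t n)).sum → u = v i) ∧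
          BCType.HasOneLine n (v i)
            (BCType.complUp n ({1} ∪ i.toFinset ∪ (BCType.predSeq i).toFinset) ++
              BCType.negSeq (BCType.predSeq i) ++ [1] ++ i) ∧
          BCType.HasOneLine n (BCType.s t n 1 * BCType.wordProd t n i * v i)
            (BCType.complUp n ({1} ∪ i.toFinset ∪ (BCType.predSeq i).toFinset) ++
              BCType.negSeq i ++ [-1] ++ BCType.predSeq i) ∧
          (BCType.s t n 1 * BCType.wordProd t n i * v i) ω = -(v i ω)) ∧
        BCType.minimalNonpos t n {(r : ℤ)} ω =
          (fun i => BCType.s t n 1 * BCType.wordProd t n i * v i) '' BCType.J m 3 n) ∧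
    -- (iv)
    (r = n →
      ∃ w, BCType.HasOneLine n w
          ((List.range (n - 1)).map (fun j : ℕ => (j : ℤ) + 2) ++ [-1]) ∧
        BCType.minimalNonpos t n {(r : ℤ)} ω = {w}) := by
  open BCType SignedPerm in
  refine ⟨?_, ?_, ?_, ?_, ?_⟩
  · rintro k rfl rfl
    simpa [show (2 * k + 1) / 2 = k by omega] using
      exists_minimalNonpos_one (by exact_mod_cast hω) hrn
  · rintro k rfl rfl
    simpa [Int.add_emod, show (2 * k + 1 + 1) / 2 = k + 1 by omega,
      show (2 * k + 1) / 2 = k by omega] using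
      exists_minimalNonpos_one (by exact_mod_cast hω) hrn
  · intro m hr₂ _ hm
    obtain ⟨v, hv, hmin⟩ := exists_minimalNonpos_eq_image (word := id) hω ⟨hr, hrn⟩
      fun l => by simpa using isAdmissible_iff_mem_J_two hm
    refine ⟨v, fun i hi => ?_, hmin⟩
    obtain ⟨hl, hv⟩ : IsSparse n i ∧ HasWeight n r (blockSum i) (v i) := hv i hi
    have := hv.blockSum_spec hl hω ⟨hr₂, hrn⟩
    rwa [vec_blockSum_of_mem_J_two t hl hi, erase_one_of_mem_J_two hi,
      ← List.append_assoc, ← List.append_assoc] at this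
  · intro m hr₂ _ hm
    obtain ⟨v, hv, hmin⟩ := exists_minimalNonpos_eq_image hω ⟨hr, hrn⟩
      fun _ => isAdmissible_iff_mem_J_three ⟨hr, hrn⟩ hm
    refine ⟨v, fun i hi => ?_, hmin⟩
    have := (hv i hi).2.blockSum_spec (hv i hi).1 hω ⟨hr₂, hrn⟩
    rw [vec_blockSum_one_cons t (hv i hi).1, List.erase_cons_head, negSeq_cons,
      wordProd_cons] at this
    simpa only [List.toFinset_cons, Finset.insert_eq, List.append_assoc, List.singleton_append]
      using this
  · rintro rfl
    exact exists_minimalNonpos_self hω hr
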